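/- **Theorem 3.1.** For $A\in M_n(\mathbb C)$ let $\mathrm{tr}_n(A)=\frac1n\mathrm{Tr}(A)$, $|A|=(A^*A)^{1/2}$ and, for real $p\ge 1$, $\|A\|_p=\mathrm{tr}_n(|A|^p)^{1/p}$. An $n\times n$ unitary random matrix is called *standard unitary* if its distribution is the Haar probability measure on the unitary group $\mathcal U(n)$. Let $l\ge 1$. For every $n$ let $(U(s,n))_{s\in S}$ be an independent family of $n\times n$ standard unitary random matrices. Let $s_1,\dots,s_l\in S$, let $m_1,\dots,m_l\in\mathbb Z\setminus\{0\}$, and let $R_p\ge 0$, $p\ge 1$, be constants. Then $$E\left(\left|\mathrm{tr}_n\big(U(s_1,n)^{m_1}D_1(n)\,U(s_2,n)^{m_2}D_2(n)\cdots U(s_l,n)^{m_l}D_l(n)\big)\right|^2\right)$$ is $O(n^{-2})$ as $n\to\infty$, uniformly over all choices of deterministic matrices $D_r(n)\in M_n(\mathbb C)$ ($1\le r\le l$, $n\in\mathbb N$) such that, for each $r$, either $$\mathrm{tr}_n(D_r(n))=0\ \text{ and }\ \|D_r(n)\|_p\le R_p\quad\text{for all } p\ge 1 \text{ and all } n,$$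 or $$D_r(n)=I_n\ \text{ for all } n,\ \text{ and } s_r\ne s_{r+1}\quad(\text{with } s_{l+1}=s_1).$$ Moreover, for each $l$ there is $p_l\ge 1$, depending only on $l$, such that the same statement holds when the bounds $\|D_r(n)\|_p\le R_p$ are required only for $1\le p\le p_l$. -/

import Mathlib

open MeasureTheory ProbabilityTheory
open scoped MatrixOrder

noncomputable section

/-- The unitary group `𝒰(n)`; its topology is induced from `M_n(ℂ)`. -/
abbrev UnitaryMat (n : ℕ) : Type := Matrix.unitaryGroup (Fin n) ℂ

/-- `𝒰(n)` carries its Borel `σ`-algebra. -/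
instance instMeasurableSpaceUnitaryMat (n : ℕ) : MeasurableSpace (UnitaryMat n) :=
  borel (UnitaryMat n)

instance instBorelSpaceUnitaryMat (n : ℕ) : BorelSpace (UnitaryMat n) := ⟨rfl⟩

/-- The normalized trace `tr_n = n⁻¹ Tr` on `M_n(ℂ)`. -/
def ntr {n : ℕ} (A : Matrix (Fin n) (Fin n) ℂ) : ℂ := (n : ℂ)⁻¹ * A.trace

/-- The Schatten `p`-norm with respect to `tr_n`: `‖A‖_p = tr_n(|A|^p)^(1/p)`, where
`|A| = (A* A)^(1/2)` and its real power are given by the continuous functional calculus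
(`tr_n(|A|^p)` is real and nonnegative because `|A|^p` is positive semidefinite). -/
def schattenNorm {n : ℕ} (p : ℝ) (A : Matrix (Fin n) (Fin n) ℂ) : ℝ :=
  (ntr (CFC.abs A ^ p)).re ^ (1 / p)

/-- `U` is an `n × n` standard unitary random matrix: its distribution is the Haar probability
measure on `𝒰(n)`. -/
structure IsStandardUnitary {Ω : Type*} [MeasurableSpace Ω] (P : Measure Ω) {n : ℕ}
    (U : Ω → UnitaryMat n) : Prop where
  measurable : Measurable U
  isProbabilityMeasure : IsProbabilityMeasure (P.map U)
  isHaarMeasure : (P.map U).IsHaarMeasure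

/-- The word `V₁^{m₁} D₁ V₂^{m₂} D₂ ⋯ V_l^{m_l} D_l` in `M_n(ℂ)`. -/
def unitaryWord {l n : ℕ} (V : Fin l → UnitaryMat n) (m : Fin l → ℤ)
    (D : Fin l → Matrix (Fin n) (Fin n) ℂ) : Matrix (Fin n) (Fin n) ℂ :=
  (List.ofFn fun r : Fin l => ((V r ^ m r : UnitaryMat n) : Matrix (Fin n) (Fin n) ℂ) * D r).prod

/-- The condition on the deterministic matrices `D_r(n)`, where norm bounds are imposed for the
exponents `p ∈ K` only. The addition `r + 1` in `Fin l` is cyclic. -/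
def Admissible {S : Type*} {l : ℕ} [NeZero l] (s : Fin l → S) (K : Set ℝ) (R : ℝ → ℝ)
    (D : Fin l → (n : ℕ) → Matrix (Fin n) (Fin n) ℂ) : Prop :=
  ∀ r : Fin l,
    (∀ n, ntr (D r n) = 0 ∧ ∀ p ∈ K, schattenNorm p (D r n) ≤ R p) ∨
    ((∀ n, D r n = 1) ∧ s r ≠ s (r + 1))

/-- `E |tr_n(U(s₁,n)^{m₁} D₁(n) ⋯ U(s_l,n)^{m_l} D_l(n))|²` (a genuine expectation) is `O(n⁻²)` as
`n → ∞`, uniformly over all deterministic matrices that are admissible for the exponents in `K`. -/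
def UniformlyBigO {S Ω : Type*} [MeasurableSpace Ω] (P : Measure Ω) {l : ℕ} [NeZero l]
    (U : S → (n : ℕ) → Ω → UnitaryMat n) (s : Fin l → S) (m : Fin l → ℤ)
    (K : Set ℝ) (R : ℝ → ℝ) : Prop :=
  ∃ (C : ℝ) (N : ℕ), ∀ D : Fin l → (n : ℕ) → Matrix (Fin n) (Fin n) ℂ, Admissible s K R D →
    ∀ n ≥ N,
      Integrable (fun ω => ‖ntr (unitaryWord (fun r => U (s r) n ω) m fun r => D r n)‖ ^ 2) P ∧
      ∫ ω, ‖ntr (unitaryWord (fun r => U (s r) n ω) m fun r => D r n)‖ ^ 2 ∂P ≤ C / (n : ℝ) ^ 2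

end

noncomputable section

open Matrix

/-! ### Dyadic Schatten moments and Hölder's inequality -/

section Moments

variable {n : ℕ}

/-! The proof is an induction on word length driven by a Schwinger–Dyson equation. The product is
read as a word w in letters u_i^{±1}, each followed by a centered matrix or the identity. The
hypotheses make w cyclically reduced: no letter meets its inverse across an identity, even around
the cycle.

Suppose w begins with u_i, and put T = tr_n w. Integrating by parts along u_i ↦ exp(tX) u_i and
summing over matrix units X (`integral_wordSplit_mul_star_trace`) gives E|T|² = -E[Q conj T] + n⁻²
E[R]. Here Q is the signed sum of products of two normalized traces got by splitting w at the other
occurrences of u_i^{±1}, and R is bounded. Absorbing half of E|T|² leaves E|T|² ≤ E|Q|² + O(n⁻²)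
(`integral_norm_ntr_sq_le`). A word beginning with an inverse letter is treated by inversion
invariance.

In each product in Q the second factor need only be bounded; the first is the trace of a shorter
word (`integral_norm_wordSplit_sq_le`). Split at u_i, that word is again cyclically reduced. Split
at u_i⁻¹, its outer letters cancel and leave a reduced word with a coefficient in front.
`chainDecay_of_traceDecay` handles this one: rotate the coefficient to the end, merge and recenter.
The scalar part gives a word that is cyclically reduced or whose two ends cancel, which shortens it
again.

Boundedness comes from Hölder's inequality. Each non-identity coefficient doubles the exponent
needed, so l coefficients use only p = 2, 4, ..., 2^(l+1), and p_l = 2^(l+1). -/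

theorem ntr_mul_comm (A B : Matrix (Fin n) (Fin n) ℂ) : ntr (A * B) = ntr (B * A) := by
  simp [ntr, Matrix.trace_mul_comm A B]

theorem ntr_add (A B : Matrix (Fin n) (Fin n) ℂ) : ntr (A + B) = ntr A + ntr B := by
  simp [ntr, mul_add]

theorem ntr_smul (c : ℂ) (A : Matrix (Fin n) (Fin n) ℂ) : ntr (c • A) = c * ntr A := by
  simp [ntr]; ring

theorem ntr_one (hn : n ≠ 0) : ntr (1 : Matrix (Fin n) (Fin n) ℂ) = 1 := by
  simp [ntr, hn]

theorem ntr_mul_pow_comm (A B : Matrix (Fin n) (Fin n) ℂ) (m : ℕ) :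
    ntr ((A * B) ^ m) = ntr ((B * A) ^ m) := by
  cases m with
  | zero => simp
  | succ m =>
    have h : ∀ k : ℕ, (A * B) ^ k * A = A * (B * A) ^ k := by
      intro k
      induction k with
      | zero => simp
      | succ k ih => rw [pow_succ', mul_assoc, ih, pow_succ']; simp only [mul_assoc]
    rw [pow_succ, ← mul_assoc, h, ntr_mul_comm, ← mul_assoc, ← pow_succ']

/-- The moment `tr_n(|A|^(2^(j+1)))`. -/
def dyadicMoment (j : ℕ) (A : Matrix (Fin n) (Fin n) ℂ) : ℝ := (ntr ((Aᴴ * A) ^ 2 ^ j)).re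

theorem ntr_conjTranspose_mul (A B : Matrix (Fin n) (Fin n) ℂ) :
    ntr (Aᴴ * B) = (n : ℂ)⁻¹ * ∑ p : Fin n × Fin n, star (A p.1 p.2) * B p.1 p.2 := by
  rw [ntr, Matrix.trace, Fintype.sum_prod_type_right]
  simp [Matrix.mul_apply]

theorem ntr_conjTranspose_mul_self (A : Matrix (Fin n) (Fin n) ℂ) :
    ntr (Aᴴ * A) = (((n : ℝ)⁻¹ * ∑ p : Fin n × Fin n, ‖A p.1 p.2‖ ^ 2 : ℝ) : ℂ) := by
  rw [ntr_conjTranspose_mul]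
  push_cast
  congr 1
  refine Finset.sum_congr rfl fun p _ => ?_
  rw [← Complex.conj_mul' (A p.1 p.2)]; rfl

theorem dyadicMoment_zero (A : Matrix (Fin n) (Fin n) ℂ) :
    dyadicMoment 0 A = (n : ℝ)⁻¹ * ∑ p : Fin n × Fin n, ‖A p.1 p.2‖ ^ 2 := by
  rw [dyadicMoment, pow_zero, pow_one, ntr_conjTranspose_mul_self, Complex.ofReal_re]

theorem norm_ntr_conjTranspose_mul_self (A : Matrix (Fin n) (Fin n) ℂ) :
    ‖ntr (Aᴴ * A)‖ = dyadicMoment 0 A := by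
  rw [dyadicMoment_zero, ntr_conjTranspose_mul_self, Complex.norm_real, Real.norm_of_nonneg]
  positivity

theorem norm_ntr_conjTranspose_mul_sq_le (A B : Matrix (Fin n) (Fin n) ℂ) :
    ‖ntr (Aᴴ * B)‖ ^ 2 ≤ dyadicMoment 0 A * dyadicMoment 0 B := by
  rw [ntr_conjTranspose_mul, dyadicMoment_zero, dyadicMoment_zero, norm_mul, mul_pow]
  have h1 : ‖∑ p : Fin n × Fin n, star (A p.1 p.2) * B p.1 p.2‖ ≤
      ∑ p : Fin n × Fin n, ‖A p.1 p.2‖ * ‖B p.1 p.2‖ := by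
    refine (norm_sum_le _ _).trans (Finset.sum_le_sum fun p _ => ?_)
    rw [norm_mul, norm_star]
  have h2 := pow_le_pow_left₀ (norm_nonneg _) h1 2
  have h3 := h2.trans (Finset.sum_mul_sq_le_sq_mul_sq _ _ _)
  have h4 : ‖(n : ℂ)⁻¹‖ = (n : ℝ)⁻¹ := by simp
  rw [h4]
  calc _ ≤ ((n : ℝ)⁻¹) ^ 2 * _ := mul_le_mul_of_nonneg_left h3 (by positivity)
    _ = _ := by ring

theorem dyadicMoment_conjTranspose (j : ℕ) (A : Matrix (Fin n) (Fin n) ℂ) :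
    dyadicMoment j Aᴴ = dyadicMoment j A := by
  rw [dyadicMoment, dyadicMoment, conjTranspose_conjTranspose, ntr_mul_pow_comm]

theorem norm_ntr_mul_sq_le (A B : Matrix (Fin n) (Fin n) ℂ) :
    ‖ntr (A * B)‖ ^ 2 ≤ dyadicMoment 0 A * dyadicMoment 0 B := by
  have := norm_ntr_conjTranspose_mul_sq_le Aᴴ B
  rwa [conjTranspose_conjTranspose, dyadicMoment_conjTranspose] at this

theorem dyadicMoment_succ (j : ℕ) (A : Matrix (Fin n) (Fin n) ℂ) :
    dyadicMoment (j + 1) A = dyadicMoment 0 ((Aᴴ * A) ^ 2 ^ j) := by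
  rw [dyadicMoment, dyadicMoment, pow_zero, pow_one, conjTranspose_pow, conjTranspose_mul,
    conjTranspose_conjTranspose, ← pow_add, pow_succ, mul_two]

theorem dyadicMoment_succ' (j : ℕ) (A : Matrix (Fin n) (Fin n) ℂ) :
    dyadicMoment (j + 1) A = dyadicMoment j (Aᴴ * A) := by
  rw [dyadicMoment, dyadicMoment, conjTranspose_mul, conjTranspose_conjTranspose, ← pow_two,
    ← pow_mul, pow_succ']

theorem norm_ntr_pow (j : ℕ) (A : Matrix (Fin n) (Fin n) ℂ) :
    ‖ntr ((Aᴴ * A) ^ 2 ^ j)‖ = dyadicMoment j A := by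
  cases j with
  | zero => rw [pow_zero, pow_one, norm_ntr_conjTranspose_mul_self]
  | succ j =>
    rw [dyadicMoment_succ, ← norm_ntr_conjTranspose_mul_self, conjTranspose_pow,
      conjTranspose_mul, conjTranspose_conjTranspose, ← pow_add, pow_succ, mul_two]

theorem dyadicMoment_nonneg (j : ℕ) (A : Matrix (Fin n) (Fin n) ℂ) : 0 ≤ dyadicMoment j A := by
  rw [← norm_ntr_pow]; exact norm_nonneg _

/-- The two claims feed each other. The second at j + 1 is the first at j for PQ, then the second at
j for P², Q². The first at j + 1 is the first at j for X², then the second at j for XᴴX and XXᴴ,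
then Cauchy–Schwarz. This Lieb–Thirring type inequality is what Hölder needs. -/
theorem norm_ntr_pow_le (j : ℕ) :
    (∀ X : Matrix (Fin n) (Fin n) ℂ, ‖ntr (X ^ (2 * 2 ^ j))‖ ≤ dyadicMoment j X) ∧
    (∀ P Q : Matrix (Fin n) (Fin n) ℂ, Pᴴ = P → Qᴴ = Q →
      ‖ntr ((P * Q) ^ 2 ^ j)‖ ≤ ‖ntr (P ^ 2 ^ j * Q ^ 2 ^ j)‖) := by
  induction j with
  | zero =>
    refine ⟨fun X => ?_, fun P Q _ _ => by simp⟩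
    have := norm_ntr_mul_sq_le X X
    rw [← pow_two (dyadicMoment 0 X)] at this
    rw [pow_zero, mul_one, pow_two]
    exact (sq_le_sq₀ (norm_nonneg _) (dyadicMoment_nonneg _ _)).1 this
  | succ j ih =>
    obtain ⟨ih1, ih2⟩ := ih
    constructor
    · intro X
      have e : X ^ (2 * 2 ^ (j + 1)) = (X ^ 2) ^ (2 * 2 ^ j) := by
        rw [← pow_mul]; congr 1; ring
      rw [e]
      refine (ih1 _).trans ?_
      rw [← norm_ntr_pow]
      have e2 : ntr (((X ^ 2)ᴴ * X ^ 2) ^ 2 ^ j) = ntr (((Xᴴ * X) * (X * Xᴴ)) ^ 2 ^ j) := by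
        rw [conjTranspose_pow, pow_two, pow_two, mul_assoc, ntr_mul_pow_comm]
        simp only [mul_assoc]
      rw [e2]
      refine (ih2 _ _ (by simp) (by simp)).trans ?_
      have h := norm_ntr_mul_sq_le ((Xᴴ * X) ^ 2 ^ j) ((X * Xᴴ) ^ 2 ^ j)
      have e3 : dyadicMoment 0 ((X * Xᴴ) ^ 2 ^ j) = dyadicMoment (j + 1) X := by
        rw [← dyadicMoment_conjTranspose (j + 1) X, dyadicMoment_succ, conjTranspose_conjTranspose]
      rw [e3, ← dyadicMoment_succ, ← pow_two] at h
      exact (sq_le_sq₀ (norm_nonneg _) (dyadicMoment_nonneg _ _)).1 h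
    · intro P Q hP hQ
      rw [pow_succ', pow_mul, pow_mul, pow_mul, ← pow_mul]
      refine (ih1 _).trans ?_
      rw [← norm_ntr_pow]
      have e2 : ntr (((P * Q)ᴴ * (P * Q)) ^ 2 ^ j) = ntr ((P ^ 2 * Q ^ 2) ^ 2 ^ j) := by
        rw [conjTranspose_mul, hP, hQ, mul_assoc, ntr_mul_pow_comm, pow_two, pow_two]
        simp only [mul_assoc]
      rw [e2]
      exact ih2 _ _ (by rw [conjTranspose_pow, hP]) (by rw [conjTranspose_pow, hQ])

/-- Hölder's inequality `‖A B‖_p ≤ ‖A‖_{2p} ‖B‖_{2p}` for dyadic `p`. -/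
theorem dyadicMoment_mul_sq_le (j : ℕ) (A B : Matrix (Fin n) (Fin n) ℂ) :
    dyadicMoment j (A * B) ^ 2 ≤ dyadicMoment (j + 1) A * dyadicMoment (j + 1) B := by
  have e : ntr (((A * B)ᴴ * (A * B)) ^ 2 ^ j) = ntr (((Aᴴ * A) * (B * Bᴴ)) ^ 2 ^ j) := by
    rw [conjTranspose_mul, mul_assoc, ntr_mul_pow_comm]
    simp only [mul_assoc]
  rw [← norm_ntr_pow, e]
  refine (pow_le_pow_left₀ (norm_nonneg _)
    ((norm_ntr_pow_le j).2 _ _ (by simp) (by simp)) 2).trans ?_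
  refine (norm_ntr_mul_sq_le _ _).trans (le_of_eq ?_)
  rw [← dyadicMoment_conjTranspose (j + 1) B, dyadicMoment_succ, dyadicMoment_succ,
    conjTranspose_conjTranspose]

/-- With a common bound for both factors, a product costs one level but leaves the constant
unchanged. -/
theorem dyadicMoment_mul_le {j : ℕ} {A B : Matrix (Fin n) (Fin n) ℂ} {C : ℝ} (hC : 0 ≤ C)
    (hA : dyadicMoment (j + 1) A ≤ C) (hB : dyadicMoment (j + 1) B ≤ C) :
    dyadicMoment j (A * B) ≤ C := by
  refine le_of_sq_le_sq ?_ hC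
  refine (dyadicMoment_mul_sq_le j A B).trans ?_
  rw [pow_two]
  exact mul_le_mul hA hB (dyadicMoment_nonneg _ _) hC

theorem dyadicMoment_zero_add_le (A B : Matrix (Fin n) (Fin n) ℂ) :
    dyadicMoment 0 (A + B) ≤ 2 * dyadicMoment 0 A + 2 * dyadicMoment 0 B := by
  simp only [dyadicMoment_zero]
  have : ∑ p : Fin n × Fin n, ‖(A + B) p.1 p.2‖ ^ 2 ≤
      ∑ p : Fin n × Fin n, (2 * ‖A p.1 p.2‖ ^ 2 + 2 * ‖B p.1 p.2‖ ^ 2) := by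
    refine Finset.sum_le_sum fun p _ => ?_
    have h1 := pow_le_pow_left₀ (norm_nonneg _) (norm_add_le (A p.1 p.2) (B p.1 p.2)) 2
    rw [Matrix.add_apply]
    nlinarith [sq_nonneg (‖A p.1 p.2‖ - ‖B p.1 p.2‖)]
  rw [Finset.sum_add_distrib, ← Finset.mul_sum, ← Finset.mul_sum] at this
  have h2 := mul_le_mul_of_nonneg_left this (inv_nonneg.2 (Nat.cast_nonneg (α := ℝ) n))
  linarith

/-- Expanding (A + B)ᴴ(A + B) gives four products, each controlled by Hölder. Adding them takes two
nested uses of the induction hypothesis, so the constant is squared. -/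
theorem dyadicMoment_add_le (j : ℕ) : ∀ {A B : Matrix (Fin n) (Fin n) ℂ} {C : ℝ}, 0 ≤ C →
    dyadicMoment j A ≤ C → dyadicMoment j B ≤ C →
    dyadicMoment j (A + B) ≤ 4 ^ 2 ^ j * C := by
  induction j with
  | zero =>
    intro A B C _ hA hB
    have := dyadicMoment_zero_add_le A B
    rw [pow_zero, pow_one]; linarith
  | succ j ih =>
    intro A B C hC hA hB
    have hA' := hA
    have hB' := hB
    rw [← dyadicMoment_conjTranspose] at hA' hB'
    rw [dyadicMoment_succ']
    have e : (A + B)ᴴ * (A + B) = (Aᴴ * A + Aᴴ * B) + (Bᴴ * A + Bᴴ * B) := by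
      rw [conjTranspose_add, add_mul, mul_add, mul_add]
    have h := ih (C := 4 ^ 2 ^ j * C) (by positivity)
      (ih hC (dyadicMoment_mul_le hC hA' hA) (dyadicMoment_mul_le hC hA' hB))
      (ih hC (dyadicMoment_mul_le hC hB' hA) (dyadicMoment_mul_le hC hB' hB))
    rw [e]
    refine h.trans (le_of_eq ?_)
    rw [← mul_assoc, ← pow_add, pow_succ, mul_two]

theorem dyadicMoment_smul (j : ℕ) (c : ℂ) (A : Matrix (Fin n) (Fin n) ℂ) :
    dyadicMoment j (c • A) = (‖c‖ ^ 2) ^ 2 ^ j * dyadicMoment j A := by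
  rw [← norm_ntr_pow, conjTranspose_smul, smul_mul_smul_comm, smul_pow, ntr_smul, norm_mul,
    norm_ntr_pow, norm_pow, norm_mul, norm_star, pow_two]

theorem dyadicMoment_one (hn : n ≠ 0) (j : ℕ) :
    dyadicMoment j (1 : Matrix (Fin n) (Fin n) ℂ) = 1 := by
  simp [dyadicMoment, ntr_one hn]

theorem dyadicMoment_unitary_mul (j : ℕ) {V : Matrix (Fin n) (Fin n) ℂ} (hV : Vᴴ * V = 1)
    (A : Matrix (Fin n) (Fin n) ℂ) : dyadicMoment j (V * A) = dyadicMoment j A := by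
  rw [dyadicMoment, dyadicMoment, conjTranspose_mul, mul_assoc, ← mul_assoc _ V, hV, one_mul]

theorem dyadicMoment_mul_unitary (j : ℕ) {V : Matrix (Fin n) (Fin n) ℂ} (hV : V * Vᴴ = 1)
    (A : Matrix (Fin n) (Fin n) ℂ) : dyadicMoment j (A * V) = dyadicMoment j A := by
  rw [← dyadicMoment_conjTranspose, conjTranspose_mul, dyadicMoment_unitary_mul,
    dyadicMoment_conjTranspose]
  rwa [conjTranspose_conjTranspose]

theorem norm_ntr_sq_le (A : Matrix (Fin n) (Fin n) ℂ) : ‖ntr A‖ ^ 2 ≤ dyadicMoment 0 A := by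
  rcases eq_or_ne n 0 with rfl | hn
  · simpa [ntr] using dyadicMoment_nonneg 0 A
  · have := norm_ntr_mul_sq_le 1 A
    rwa [one_mul, dyadicMoment_one hn, one_mul] at this

/-- All dyadic moments up to level `J` are at most `B`. -/
def MomentBound (J : ℕ) (B : ℝ) (A : Matrix (Fin n) (Fin n) ℂ) : Prop :=
  ∀ j ≤ J, dyadicMoment j A ≤ B

theorem MomentBound.mono {J J' : ℕ} {B B' : ℝ} {A : Matrix (Fin n) (Fin n) ℂ}
    (h : MomentBound J B A) (hJ : J' ≤ J) (hB : B ≤ B') : MomentBound J' B' A :=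
  fun j hj => (h j (hj.trans hJ)).trans hB

theorem MomentBound.mul {J : ℕ} {B : ℝ} (hB : 0 ≤ B) {A A' : Matrix (Fin n) (Fin n) ℂ}
    (h : MomentBound (J + 1) B A) (h' : MomentBound (J + 1) B A') : MomentBound J B (A * A') :=
  fun j hj => dyadicMoment_mul_le hB (h _ (by omega)) (h' _ (by omega))

theorem MomentBound.unitary_mul {J : ℕ} {B : ℝ} {A V : Matrix (Fin n) (Fin n) ℂ}
    (hV : Vᴴ * V = 1) (h : MomentBound J B A) : MomentBound J B (V * A) :=
  fun j hj => by rw [dyadicMoment_unitary_mul j hV]; exact h j hj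

theorem momentBound_one (J : ℕ) {B : ℝ} (hB : 1 ≤ B) :
    MomentBound J B (1 : Matrix (Fin n) (Fin n) ℂ) := by
  intro j _
  rcases eq_or_ne n 0 with rfl | hn
  · simp [dyadicMoment, ntr]; linarith
  · rwa [dyadicMoment_one hn]

theorem MomentBound.norm_ntr_sq_le {J : ℕ} {B : ℝ} {A : Matrix (Fin n) (Fin n) ℂ}
    (h : MomentBound J B A) : ‖ntr A‖ ^ 2 ≤ B :=
  (_root_.norm_ntr_sq_le A).trans (h 0 (Nat.zero_le _))

/-- The centering of a matrix. -/
def centered (A : Matrix (Fin n) (Fin n) ℂ) : Matrix (Fin n) (Fin n) ℂ := A + (-ntr A) • 1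

theorem ntr_centered (hn : n ≠ 0) (A : Matrix (Fin n) (Fin n) ℂ) : ntr (centered A) = 0 := by
  rw [centered, ntr_add, ntr_smul, ntr_one hn]; ring

theorem MomentBound.centered {J : ℕ} {B : ℝ} (hB : 1 ≤ B) {A : Matrix (Fin n) (Fin n) ℂ}
    (h : MomentBound J B A) : MomentBound J (4 ^ 2 ^ J * B ^ 2 ^ J) (centered A) := by
  intro j hj
  have hj2 : 2 ^ j ≤ 2 ^ J := Nat.pow_le_pow_right (by norm_num) hj
  have h1 : B ≤ B ^ 2 ^ j := by
    calc B = B ^ 1 := (pow_one B).symm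
      _ ≤ B ^ 2 ^ j := pow_le_pow_right₀ hB Nat.one_le_two_pow
  have hs : dyadicMoment j ((-ntr A) • (1 : Matrix (Fin n) (Fin n) ℂ)) ≤ B ^ 2 ^ j := by
    rw [dyadicMoment_smul, norm_neg]
    have h2 : dyadicMoment j (1 : Matrix (Fin n) (Fin n) ℂ) ≤ 1 :=
      momentBound_one J le_rfl j hj
    have h3 := pow_le_pow_left₀ (by positivity) h.norm_ntr_sq_le (2 ^ j)
    calc _ ≤ B ^ 2 ^ j * 1 := mul_le_mul h3 h2 (dyadicMoment_nonneg _ _) (by positivity)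
      _ = _ := mul_one _
  refine (dyadicMoment_add_le j (by positivity) ((h j hj).trans h1) hs).trans ?_
  exact mul_le_mul (pow_le_pow_right₀ (by norm_num) hj2) (pow_le_pow_right₀ hB hj2)
    (by positivity) (by positivity)

/-- For these exponents |A|^p is a polynomial in AᴴA, so the functional calculus disappears. -/
theorem re_ntr_abs_rpow (j : ℕ) (A : Matrix (Fin n) (Fin n) ℂ) :
    (ntr (CFC.abs A ^ ((2 : ℝ) ^ (j + 1)))).re = dyadicMoment j A := by
  have h : ((2 : ℝ) ^ (j + 1)) = ((2 ^ (j + 1) : ℕ) : ℝ) := by push_cast; rfl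
  rw [h, CFC.rpow_natCast _ _ (CFC.abs_nonneg A), pow_succ', pow_mul, pow_two, CFC.abs_mul_abs]
  rfl

theorem dyadicMoment_le_of_schattenNorm_le {j : ℕ} {A : Matrix (Fin n) (Fin n) ℂ} {r : ℝ}
    (h : schattenNorm ((2 : ℝ) ^ (j + 1)) A ≤ r) : dyadicMoment j A ≤ r ^ 2 ^ (j + 1) := by
  rw [schattenNorm, re_ntr_abs_rpow] at h
  have h0 := dyadicMoment_nonneg j A
  have h1 := pow_le_pow_left₀ (Real.rpow_nonneg h0 _) h (2 ^ (j + 1))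
  rwa [← Real.rpow_natCast, ← Real.rpow_mul h0, Nat.cast_pow, Nat.cast_ofNat, one_div,
    inv_mul_cancel₀ (by positivity), Real.rpow_one] at h1

end Moments

/-! ### Compactness of the unitary group and its one-parameter subgroups -/

section UnitaryGroup

variable {n : ℕ}

instance : SecondCountableTopology (Matrix (Fin n) (Fin n) ℂ) :=
  inferInstanceAs (SecondCountableTopology (Fin n → Fin n → ℂ))

instance : SecondCountableTopology (UnitaryMat n) :=
  TopologicalSpace.Subtype.secondCountableTopology _

instance : CompactSpace (UnitaryMat n) := by
  refine isCompact_iff_compactSpace.1 ?_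
  have hK : IsCompact (Set.univ.pi fun _ : Fin n => Set.univ.pi fun _ : Fin n =>
      Metric.closedBall (0 : ℂ) 1) :=
    isCompact_univ_pi fun _ => isCompact_univ_pi fun _ => isCompact_closedBall _ _
  have hcl : IsClosed ((Matrix.unitaryGroup (Fin n) ℂ : Set (Matrix (Fin n) (Fin n) ℂ))) := by
    have : ((Matrix.unitaryGroup (Fin n) ℂ : Set (Matrix (Fin n) (Fin n) ℂ))) =
        {A | A * star A = 1} := by
      ext A; exact Matrix.mem_unitaryGroup_iff
    rw [this]
    exact isClosed_eq (by fun_prop) continuous_const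
  refine IsCompact.of_isClosed_subset (X := Matrix (Fin n) (Fin n) ℂ) hK hcl ?_
  intro A hA
  exact fun i _ j _ => mem_closedBall_zero_iff.2 (entry_norm_bound_of_unitary hA i j)

/-- A one-parameter group of unitary matrices with skew-adjoint generator. -/
def unitaryExp (X : Matrix (Fin n) (Fin n) ℂ) (hX : Xᴴ = -X) (t : ℝ) : UnitaryMat n :=
  ⟨NormedSpace.exp (t • X), by
    rw [Matrix.mem_unitaryGroup_iff', star_eq_conjTranspose, ← Matrix.exp_conjTranspose,
      conjTranspose_smul, hX, smul_neg, star_trivial, ← Matrix.exp_add_of_commute,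
      neg_add_cancel, NormedSpace.exp_zero]
    exact (Commute.refl _).neg_left⟩

theorem unitaryExp_add (X : Matrix (Fin n) (Fin n) ℂ) (hX : Xᴴ = -X) (s t : ℝ) :
    unitaryExp X hX (s + t) = unitaryExp X hX s * unitaryExp X hX t := by
  apply Subtype.ext
  simp only [unitaryExp, Submonoid.coe_mul, add_smul]
  exact Matrix.exp_add_of_commute _ _ (((Commute.refl X).smul_left s).smul_right t)

theorem unitaryExp_zero (X : Matrix (Fin n) (Fin n) ℂ) (hX : Xᴴ = -X) :
    unitaryExp X hX 0 = 1 := by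
  apply Subtype.ext
  simp [unitaryExp]

section
attribute [local instance] Matrix.linftyOpNormedRing Matrix.linftyOpNormedAlgebra

theorem hasDerivAt_unitaryExp (X : Matrix (Fin n) (Fin n) ℂ) (hX : Xᴴ = -X) (a b : Fin n) :
    HasDerivAt (fun t => (unitaryExp X hX t : Matrix (Fin n) (Fin n) ℂ) a b) (X a b) 0 := by
  have h := hasDerivAt_exp_smul_const (𝕂 := ℝ) X 0
  rw [zero_smul, NormedSpace.exp_zero, one_mul] at h
  let L : Matrix (Fin n) (Fin n) ℂ →ₗ[ℝ] ℂ :=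
    { toFun := fun A => A a b, map_add' := fun _ _ => rfl, map_smul' := fun _ _ => rfl }
  exact (LinearMap.toContinuousLinearMap L).hasFDerivAt.comp_hasDerivAt (0 : ℝ) h

end

theorem hasDerivAt_matrix_mul {A B : ℝ → Matrix (Fin n) (Fin n) ℂ}
    {A' B' : Matrix (Fin n) (Fin n) ℂ} {t : ℝ}
    (hA : ∀ a b, HasDerivAt (fun t => A t a b) (A' a b) t)
    (hB : ∀ a b, HasDerivAt (fun t => B t a b) (B' a b) t) (a b : Fin n) :
    HasDerivAt (fun t => (A t * B t) a b) ((A' * B t + A t * B') a b) t := by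
  simp only [Matrix.mul_apply, Matrix.add_apply, ← Finset.sum_add_distrib]
  exact HasDerivAt.fun_sum fun c _ => (hA a c).mul (hB c b)

theorem hasDerivAt_conjTranspose {A : ℝ → Matrix (Fin n) (Fin n) ℂ}
    {A' : Matrix (Fin n) (Fin n) ℂ} {t : ℝ}
    (hA : ∀ a b, HasDerivAt (fun t => A t a b) (A' a b) t) (a b : Fin n) :
    HasDerivAt (fun t => (A t)ᴴ a b) (A'ᴴ a b) t :=
  (hA b a).star

end UnitaryGroup

/-! ### Integration by parts and inversion on compact groups -/

section CompactGroup

variable {G : Type*} [TopologicalSpace G] [CompactSpace G] [MeasurableSpace G] [BorelSpace G]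

theorem integrable_of_continuous {E : Type*} [NormedAddCommGroup E] {μ : Measure G}
    [IsFiniteMeasure μ] {f : G → E} (hf : Continuous f) : Integrable f μ :=
  hf.integrable_of_hasCompactSupport (HasCompactSupport.of_compactSpace f)

variable [Group G] [IsTopologicalGroup G]

/-- By left invariance t ↦ ∫ F(g t u) is constant; compactness bounds F' and allows differentiation
under the integral. -/
theorem integral_eq_zero_of_hasDerivAt (μ : Measure G) [IsProbabilityMeasure μ]
    [μ.IsMulLeftInvariant] (g : ℝ → G) (hg : ∀ s t, g (s + t) = g s * g t) {F F' : G → ℂ}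
    (hF : Continuous F) (hF' : Continuous F')
    (hd : ∀ u, HasDerivAt (fun t => F (g t * u)) (F' u) 0) : ∫ u, F' u ∂μ = 0 := by
  obtain ⟨C, hC⟩ := (isCompact_range hF'.norm).bddAbove
  have hd' : ∀ u t, HasDerivAt (fun t => F (g t * u)) (F' (g t * u)) t := by
    intro u t
    have h := HasDerivAt.comp_sub_const t t (f := fun s => F (g s * (g t * u)))
      (f' := F' (g t * u)) (by rw [sub_self]; exact hd (g t * u))
    refine h.congr_of_eventuallyEq (Filter.Eventually.of_forall fun s => ?_)
    simp only
    rw [← mul_assoc, ← hg, sub_add_cancel]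
  have key := (hasDerivAt_integral_of_dominated_loc_of_deriv_le (μ := μ) (𝕜 := ℝ)
    (F := fun t u => F (g t * u)) (F' := fun t u => F' (g t * u)) (x₀ := 0) (s := Set.univ)
    (bound := fun _ => C) Filter.univ_mem
    (Filter.Eventually.of_forall fun t =>
      (integrable_of_continuous (hF.comp (continuous_const_mul (g t)))).aestronglyMeasurable)
    (integrable_of_continuous (hF.comp (continuous_const_mul (g 0))))
    (integrable_of_continuous (hF'.comp (continuous_const_mul (g 0)))).aestronglyMeasurable
    (Filter.Eventually.of_forall fun u t _ => hC ⟨g t * u, rfl⟩)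
    (integrable_const _)
    (Filter.Eventually.of_forall fun u t _ => hd' u t)).2
  simp only [integral_mul_left_eq_self (μ := μ) F, integral_mul_left_eq_self (μ := μ) F'] at key
  exact key.unique (hasDerivAt_const _ _)

/-- Integrating f(x⁻¹y) in the two orders yields the two sides; only left invariance is used. -/
theorem integral_inv_eq_of_continuous [SecondCountableTopology G] (μ : Measure G)
    [IsProbabilityMeasure μ] [μ.IsMulLeftInvariant] {f : G → ℝ} (hf : Continuous f) :
    ∫ u, f u⁻¹ ∂μ = ∫ u, f u ∂μ := by
  have h := integral_integral_swap (μ := μ) (ν := μ) (f := fun x y => f (x⁻¹ * y))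
    (integrable_of_continuous (by fun_prop))
  have h1 : ∀ x, ∫ y, f (x⁻¹ * y) ∂μ = ∫ y, f y ∂μ := fun x => integral_mul_left_eq_self f x⁻¹
  have h2 : ∀ y, ∫ x, f (x⁻¹ * y) ∂μ = ∫ x, f x⁻¹ ∂μ := by
    intro y
    rw [← integral_mul_left_eq_self (fun x => f x⁻¹) y⁻¹]
    simp
  simp only [h1, h2, integral_const, probReal_univ, one_smul] at h
  exact h.symm

end CompactGroup

/-! ### Words, their derivatives and the Schwinger–Dyson equation -/

section Words

variable {n : ℕ} {ι : Type*}

/-- A letter `u i` or `(u i)⁻¹` of a word, followed by a matrix; `none` stands for the identity. -/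
abbrev Atom (ι : Type*) (n : ℕ) : Type _ := (ι × Bool) × Option (Matrix (Fin n) (Fin n) ℂ)

/-- The value of a letter. -/
def letterVal (x : ι × Bool) (u : ι → UnitaryMat n) : Matrix (Fin n) (Fin n) ℂ :=
  if x.2 then (u x.1 : Matrix (Fin n) (Fin n) ℂ) else (u x.1 : Matrix (Fin n) (Fin n) ℂ)ᴴ

/-- The matrix denoted by an optional coefficient. -/
def coefVal (a : Option (Matrix (Fin n) (Fin n) ℂ)) : Matrix (Fin n) (Fin n) ℂ := a.getD 1

/-- The value of a word. -/
def wordVal : List (Atom ι n) → (ι → UnitaryMat n) → Matrix (Fin n) (Fin n) ℂ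
  | [], _ => 1
  | x :: w, u => letterVal x.1 u * coefVal x.2 * wordVal w u

theorem wordVal_append (v w : List (Atom ι n)) (u : ι → UnitaryMat n) :
    wordVal (v ++ w) u = wordVal v u * wordVal w u := by
  induction v with
  | nil => simp [wordVal]
  | cons x v ih => simp [wordVal, ih, mul_assoc]

theorem unitary_conjTranspose_mul_self (V : UnitaryMat n) :
    (V : Matrix (Fin n) (Fin n) ℂ)ᴴ * V = 1 := Matrix.mem_unitaryGroup_iff'.1 V.2

theorem unitary_mul_conjTranspose_self (V : UnitaryMat n) :
    (V : Matrix (Fin n) (Fin n) ℂ) * (V : Matrix (Fin n) (Fin n) ℂ)ᴴ = 1 :=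
  Matrix.mem_unitaryGroup_iff.1 V.2

theorem letterVal_conjTranspose_mul_self (x : ι × Bool) (u : ι → UnitaryMat n) :
    (letterVal x u)ᴴ * letterVal x u = 1 := by
  unfold letterVal
  split_ifs
  · exact unitary_conjTranspose_mul_self _
  · rw [conjTranspose_conjTranspose]; exact unitary_mul_conjTranspose_self _

theorem letterVal_mul_conjTranspose_self (x : ι × Bool) (u : ι → UnitaryMat n) :
    letterVal x u * (letterVal x u)ᴴ = 1 :=
  mul_eq_one_comm.1 (letterVal_conjTranspose_mul_self x u)

theorem letterVal_not (i : ι) (b : Bool) (u : ι → UnitaryMat n) :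
    letterVal (i, !b) u = (letterVal (i, b) u)ᴴ := by
  cases b <;> simp [letterVal]

@[fun_prop]
theorem continuous_letterVal (x : ι × Bool) : Continuous (letterVal (n := n) x) := by
  have h : Continuous fun u : ι → UnitaryMat n => (u x.1 : Matrix (Fin n) (Fin n) ℂ) :=
    continuous_subtype_val.comp (continuous_apply x.1)
  unfold letterVal
  split_ifs
  · exact h
  · exact h.matrix_conjTranspose

@[fun_prop]
theorem continuous_wordVal (w : List (Atom ι n)) : Continuous (wordVal w) := by
  induction w with
  | nil => exact continuous_const
  | cons x w ih =>
    exact ((continuous_letterVal x.1).mul continuous_const).mul ih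

variable [DecidableEq ι]

/-- The derivative of a letter in the direction `X` at the index `i`. -/
def letterDeriv (i : ι) (X : Matrix (Fin n) (Fin n) ℂ) (x : ι × Bool) (u : ι → UnitaryMat n) :
    Matrix (Fin n) (Fin n) ℂ :=
  if x.1 = i then (if x.2 then X * letterVal x u else -(letterVal x u * X)) else 0

/-- The derivative of a word in the direction `X` at the index `i`. -/
def wordDeriv (i : ι) (X : Matrix (Fin n) (Fin n) ℂ) :
    List (Atom ι n) → (ι → UnitaryMat n) → Matrix (Fin n) (Fin n) ℂ
  | [], _ => 0
  | x :: w, u => letterDeriv i X x.1 u * (coefVal x.2 * wordVal w u) +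
      letterVal x.1 u * coefVal x.2 * wordDeriv i X w u

@[fun_prop]
theorem continuous_letterDeriv (i : ι) (X : Matrix (Fin n) (Fin n) ℂ) (x : ι × Bool) :
    Continuous (letterDeriv i X x) := by
  unfold letterDeriv
  split_ifs <;> fun_prop

@[fun_prop]
theorem continuous_wordDeriv (i : ι) (X : Matrix (Fin n) (Fin n) ℂ) (w : List (Atom ι n)) :
    Continuous (wordDeriv i X w) := by
  induction w with
  | nil => exact continuous_const
  | cons x w ih =>
    have h : wordDeriv i X (x :: w) = fun u => letterDeriv i X x.1 u *
        (coefVal x.2 * wordVal w u) + letterVal x.1 u * coefVal x.2 * wordDeriv i X w u := rfl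
    rw [h]
    fun_prop

theorem letterDeriv_add_smul (i : ι) (X Y : Matrix (Fin n) (Fin n) ℂ) (c : ℂ) (x : ι × Bool)
    (u : ι → UnitaryMat n) :
    letterDeriv i (X + c • Y) x u = letterDeriv i X x u + c • letterDeriv i Y x u := by
  unfold letterDeriv
  split_ifs
  · simp [add_mul]
  · simp [mul_add, add_comm]
  · simp

theorem wordDeriv_add_smul (i : ι) (X Y : Matrix (Fin n) (Fin n) ℂ) (c : ℂ)
    (w : List (Atom ι n)) (u : ι → UnitaryMat n) :
    wordDeriv i (X + c • Y) w u = wordDeriv i X w u + c • wordDeriv i Y w u := by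
  induction w with
  | nil => simp [wordDeriv]
  | cons x w ih =>
    simp only [wordDeriv, ih, letterDeriv_add_smul, add_mul, mul_add, smul_add, Matrix.smul_mul,
      Matrix.mul_smul]
    abel

/-- The one-parameter group `t ↦ exp(tX)` placed at the index `i`. -/
def unitaryFlow (i : ι) (X : Matrix (Fin n) (Fin n) ℂ) (hX : Xᴴ = -X) (t : ℝ) :
    ι → UnitaryMat n := Pi.mulSingle i (unitaryExp X hX t)

theorem unitaryFlow_add (i : ι) (X : Matrix (Fin n) (Fin n) ℂ) (hX : Xᴴ = -X) (s t : ℝ) :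
    unitaryFlow i X hX (s + t) = unitaryFlow i X hX s * unitaryFlow i X hX t := by
  rw [unitaryFlow, unitaryExp_add, Pi.mulSingle_mul]; rfl

theorem unitaryFlow_zero (i : ι) (X : Matrix (Fin n) (Fin n) ℂ) (hX : Xᴴ = -X) :
    unitaryFlow i X hX 0 = 1 := by
  rw [unitaryFlow, unitaryExp_zero, Pi.mulSingle_one]

theorem hasDerivAt_letterVal (i : ι) (X : Matrix (Fin n) (Fin n) ℂ) (hX : Xᴴ = -X)
    (x : ι × Bool) (u : ι → UnitaryMat n) (a b : Fin n) :
    HasDerivAt (fun t => letterVal x (unitaryFlow i X hX t * u) a b)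
      (letterDeriv i X x u a b) 0 := by
  have h0 : ∀ a b, HasDerivAt (fun t => ((unitaryFlow i X hX t * u) x.1 :
      Matrix (Fin n) (Fin n) ℂ) a b)
      ((if x.1 = i then X * (u x.1 : Matrix (Fin n) (Fin n) ℂ) else 0) a b) 0 := by
    intro a b
    split_ifs with h
    · subst h
      have := hasDerivAt_matrix_mul (A := fun t => (unitaryExp X hX t : Matrix (Fin n) (Fin n) ℂ))
        (B := fun _ => (u x.1 : Matrix (Fin n) (Fin n) ℂ)) (B' := 0)
        (hasDerivAt_unitaryExp X hX) (fun a b => hasDerivAt_const _ _) a b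
      simpa [unitaryFlow] using this
    · simp only [unitaryFlow, Pi.mul_apply, Pi.mulSingle_eq_of_ne h, one_mul]
      exact hasDerivAt_const _ _
  unfold letterVal letterDeriv letterVal
  by_cases hx : x.2
  · simpa only [hx, if_true] using h0 a b
  · have h1 := hasDerivAt_conjTranspose h0 a b
    simp only [hx, Bool.false_eq_true, if_false]
    convert h1 using 1
    split_ifs
    · rw [conjTranspose_mul, hX, mul_neg]
    · simp

theorem hasDerivAt_wordVal (i : ι) (X : Matrix (Fin n) (Fin n) ℂ) (hX : Xᴴ = -X)
    (w : List (Atom ι n)) (u : ι → UnitaryMat n) : ∀ a b : Fin n,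
    HasDerivAt (fun t => wordVal w (unitaryFlow i X hX t * u) a b) (wordDeriv i X w u a b) 0 := by
  induction w with
  | nil => exact fun a b => hasDerivAt_const _ _
  | cons x w ih =>
    intro a b
    have h1 := hasDerivAt_matrix_mul
      (A := fun t => letterVal x.1 (unitaryFlow i X hX t * u)) (B := fun _ => coefVal x.2)
      (B' := 0) (hasDerivAt_letterVal i X hX x.1 u) (fun a b => hasDerivAt_const _ _)
    have h2 := hasDerivAt_matrix_mul h1 ih a b
    simp only [unitaryFlow_zero, one_mul, mul_zero, add_zero, mul_assoc] at h2
    simpa only [wordVal, wordDeriv, mul_assoc] using h2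

/-- The matrix `K` with `Tr(P (D_X w)) = Tr(X K)`. -/
def wordGrad (i : ι) : Matrix (Fin n) (Fin n) ℂ → List (Atom ι n) → (ι → UnitaryMat n) →
    Matrix (Fin n) (Fin n) ℂ
  | _, [], _ => 0
  | P, x :: w, u =>
    (if x.1.1 = i then
      (if x.1.2 then wordVal (x :: w) u * P else -(coefVal x.2 * wordVal w u * P * letterVal x.1 u))
      else 0) + wordGrad i (P * (letterVal x.1 u * coefVal x.2)) w u

theorem trace_mul_wordDeriv (i : ι) (X : Matrix (Fin n) (Fin n) ℂ) (w : List (Atom ι n))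
    (u : ι → UnitaryMat n) : ∀ P : Matrix (Fin n) (Fin n) ℂ,
    (P * wordDeriv i X w u).trace = (X * wordGrad i P w u).trace := by
  induction w with
  | nil => simp [wordDeriv, wordGrad]
  | cons x w ih =>
    intro P
    rw [wordDeriv, wordGrad, mul_add, mul_add, trace_add, trace_add,
      ← mul_assoc P _ (wordDeriv _ _ _ _), ih]
    congr 1
    unfold letterDeriv
    split_ifs
    · rw [Matrix.trace_mul_comm]; simp only [wordVal, mul_assoc]
    · simp only [neg_mul, mul_neg, trace_neg, mul_assoc]
      rw [← mul_assoc P, Matrix.trace_mul_comm]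
      simp only [mul_assoc]
    · simp

/-- The sum of the products of traces obtained by splitting a word at the letters with index `i`;
`P` is the product of the letters that were passed already. -/
def wordSplit (i : ι) : Matrix (Fin n) (Fin n) ℂ → List (Atom ι n) → (ι → UnitaryMat n) → ℂ
  | _, [], _ => 0
  | P, x :: w, u =>
    (if x.1.1 = i then
      (if x.1.2 then P.trace * (wordVal (x :: w) u).trace
        else -((P * letterVal x.1 u).trace * (coefVal x.2 * wordVal w u).trace))
      else 0) + wordSplit i (P * (letterVal x.1 u * coefVal x.2)) w u

/-- This is how summing over matrix units splits one word into a product of two traces. -/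
theorem sum_mul_single_mul_apply (P R : Matrix (Fin n) (Fin n) ℂ) :
    ∑ a, ∑ b, (P * Matrix.single a b (1 : ℂ) * R : Matrix (Fin n) (Fin n) ℂ) a b =
      P.trace * R.trace := by
  rw [Matrix.trace, Matrix.trace, Finset.sum_mul_sum]
  refine Finset.sum_congr rfl fun a _ => Finset.sum_congr rfl fun b _ => ?_
  simp [Matrix.mul_apply, Matrix.single_apply, ite_and]

theorem sum_mul_wordDeriv_apply (i : ι) (w : List (Atom ι n)) (u : ι → UnitaryMat n) :
    ∀ P : Matrix (Fin n) (Fin n) ℂ,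
    ∑ a, ∑ b, (P * wordDeriv i (Matrix.single a b 1) w u) a b = wordSplit i P w u := by
  induction w with
  | nil => simp [wordDeriv, wordSplit]
  | cons x w ih =>
    intro P
    simp only [wordDeriv, wordSplit, mul_add, Matrix.add_apply, Finset.sum_add_distrib]
    congr 1
    · unfold letterDeriv
      split_ifs
      · rw [← sum_mul_single_mul_apply]
        simp only [wordVal, mul_assoc]
      · rw [← sum_mul_single_mul_apply]
        simp only [neg_mul, mul_neg, Matrix.neg_apply, Finset.sum_neg_distrib, mul_assoc]
      · simp
    · rw [← ih]; simp only [mul_assoc]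

@[fun_prop]
theorem continuous_wordGrad (i : ι) (w : List (Atom ι n)) :
    ∀ {P : (ι → UnitaryMat n) → Matrix (Fin n) (Fin n) ℂ}, Continuous P →
      Continuous fun u => wordGrad i (P u) w u := by
  induction w with
  | nil => intro P _; exact continuous_const
  | cons x w ih =>
    intro P hP
    unfold wordGrad
    refine Continuous.add ?_ (ih (by fun_prop))
    split_ifs <;> fun_prop

theorem continuous_wordSplit (i : ι) (w : List (Atom ι n)) :
    ∀ {P : (ι → UnitaryMat n) → Matrix (Fin n) (Fin n) ℂ}, Continuous P →
      Continuous fun u => wordSplit i (P u) w u := by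
  induction w with
  | nil => intro P _; exact continuous_const
  | cons x w ih =>
    intro P hP
    unfold wordSplit
    refine Continuous.add ?_ (ih (by fun_prop))
    split_ifs
    · exact (Continuous.matrix_trace hP).mul (Continuous.matrix_trace (by fun_prop))
    · exact ((Continuous.matrix_trace (by fun_prop)).mul
        (Continuous.matrix_trace (by fun_prop))).neg
    · exact continuous_const

variable [Fintype ι]

instance : BorelSpace (ι → UnitaryMat n) := Pi.borelSpace

/-- Integration by parts on `𝒰(n)^ι` for the function `w_{ab} · conj (Tr w)`. -/
theorem integral_wordDeriv (μ : Measure (ι → UnitaryMat n)) [IsProbabilityMeasure μ]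
    [μ.IsMulLeftInvariant] (i : ι) (w : List (Atom ι n)) (a b : Fin n)
    (X : Matrix (Fin n) (Fin n) ℂ) :
    ∫ u, (wordDeriv i X w u a b * star (wordVal w u).trace -
      wordVal w u a b * ((wordGrad i 1 w u)ᴴ * X).trace) ∂μ = 0 := by
  have hc : ∀ X : Matrix (Fin n) (Fin n) ℂ, Continuous fun u : ι → UnitaryMat n =>
      (wordDeriv i X w u a b * star (wordVal w u).trace -
        wordVal w u a b * ((wordGrad i 1 w u)ᴴ * X).trace) := by
    intro X
    have h1 : Continuous fun u : ι → UnitaryMat n => wordDeriv i X w u a b :=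
      (continuous_wordDeriv i X w).matrix_elem a b
    have h2 : Continuous fun u : ι → UnitaryMat n => wordVal w u a b :=
      (continuous_wordVal w).matrix_elem a b
    have h3 : Continuous fun u : ι → UnitaryMat n => (wordVal w u).trace :=
      (continuous_wordVal w).matrix_trace
    have h4 : Continuous fun u : ι → UnitaryMat n => wordGrad i 1 w u :=
      continuous_wordGrad i w (P := fun _ => 1) continuous_const
    have h5 : Continuous fun u : ι → UnitaryMat n => ((wordGrad i 1 w u)ᴴ * X).trace :=
      (h4.matrix_conjTranspose.mul continuous_const).matrix_trace
    fun_prop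
  have hskew : ∀ X : Matrix (Fin n) (Fin n) ℂ, Xᴴ = -X →
      ∫ u, (wordDeriv i X w u a b * star (wordVal w u).trace -
        wordVal w u a b * ((wordGrad i 1 w u)ᴴ * X).trace) ∂μ = 0 := by
    intro X hX
    refine integral_eq_zero_of_hasDerivAt μ (unitaryFlow i X hX) (unitaryFlow_add i X hX)
      (F := fun u => wordVal w u a b * star (wordVal w u).trace) ?_ (hc X) ?_
    · exact ((continuous_wordVal w).matrix_elem a b).mul
        (continuous_wordVal w).matrix_trace.star
    · intro u
      have h := hasDerivAt_wordVal i X hX w u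
      have htr : HasDerivAt (fun t => (wordVal w (unitaryFlow i X hX t * u)).trace)
          (wordDeriv i X w u).trace 0 := by
        simp only [Matrix.trace, Matrix.diag_apply]
        exact HasDerivAt.fun_sum fun c _ => h c c
      -- For skew X the conjugated derivative takes a form that is complex-linear in X, which
      -- permits the extension to all X.
      have e : -((wordGrad i 1 w u)ᴴ * X).trace = star (wordDeriv i X w u).trace := by
        have h1 := trace_mul_wordDeriv i X w u 1
        rw [one_mul] at h1
        rw [h1, ← Matrix.trace_conjTranspose, conjTranspose_mul, hX, mul_neg, trace_neg]
      have h2 := (h a b).mul htr.star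
      simp only [unitaryFlow_zero, one_mul] at h2
      rw [sub_eq_add_neg, ← mul_neg, e]
      exact h2
  -- Skew-adjoint matrices span M_n(ℂ) over ℂ: X = Y + iZ with Y, Z skew.
  set Y : Matrix (Fin n) (Fin n) ℂ := (1 / 2 : ℂ) • (X - Xᴴ) with hY
  set Z : Matrix (Fin n) (Fin n) ℂ := (-Complex.I / 2) • (X + Xᴴ) with hZ
  have hXYZ : X = Y + Complex.I • Z := by
    have e : Complex.I * (-Complex.I / 2) = 1 / 2 := by
      linear_combination (-1 / 2 : ℂ) * Complex.I_mul_I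
    rw [hY, hZ, smul_smul, e, ← smul_add, sub_add_add_cancel, ← two_smul ℂ, smul_smul]
    norm_num
  have hYs : Yᴴ = -Y := by
    rw [hY, conjTranspose_smul, conjTranspose_sub, conjTranspose_conjTranspose, ← smul_neg,
      neg_sub]
    simp
  have hZs : Zᴴ = -Z := by
    rw [hZ, conjTranspose_smul, conjTranspose_add, conjTranspose_conjTranspose, ← neg_smul,
      add_comm]
    congr 1
    simp
    ring
  have e : ∀ u, (wordDeriv i X w u a b * star (wordVal w u).trace -
        wordVal w u a b * ((wordGrad i 1 w u)ᴴ * X).trace) =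
      (wordDeriv i Y w u a b * star (wordVal w u).trace -
        wordVal w u a b * ((wordGrad i 1 w u)ᴴ * Y).trace) +
      Complex.I * (wordDeriv i Z w u a b * star (wordVal w u).trace -
        wordVal w u a b * ((wordGrad i 1 w u)ᴴ * Z).trace) := by
    intro u
    rw [hXYZ, wordDeriv_add_smul]
    simp only [Matrix.add_apply, Matrix.smul_apply, mul_add, trace_add, Matrix.mul_smul,
      trace_smul, smul_eq_mul]
    ring
  simp only [e]
  rw [integral_add (integrable_of_continuous (hc Y))
    ((integrable_of_continuous (hc Z)).const_mul _), integral_const_mul, hskew Y hYs,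
    hskew Z hZs, mul_zero, add_zero]

/-- The Schwinger–Dyson equation. -/
theorem integral_wordSplit_mul_star_trace (μ : Measure (ι → UnitaryMat n))
    [IsProbabilityMeasure μ] [μ.IsMulLeftInvariant] (i : ι) (w : List (Atom ι n)) :
    ∫ u, (wordSplit i 1 w u * star (wordVal w u).trace -
      ((wordGrad i 1 w u)ᴴ * wordVal w u).trace) ∂μ = 0 := by
  have hc : ∀ a b, Continuous fun u : ι → UnitaryMat n =>
      (wordDeriv i (Matrix.single a b 1) w u a b * star (wordVal w u).trace -
        wordVal w u a b * ((wordGrad i 1 w u)ᴴ * (Matrix.single a b 1)).trace) := by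
    intro a b
    have h1 : Continuous fun u : ι → UnitaryMat n => wordDeriv i (Matrix.single a b 1) w u a b :=
      (continuous_wordDeriv i _ w).matrix_elem a b
    have h2 : Continuous fun u : ι → UnitaryMat n => wordVal w u a b :=
      (continuous_wordVal w).matrix_elem a b
    have h3 : Continuous fun u : ι → UnitaryMat n => (wordVal w u).trace :=
      (continuous_wordVal w).matrix_trace
    have h4 : Continuous fun u : ι → UnitaryMat n => wordGrad i 1 w u :=
      continuous_wordGrad i w (P := fun _ => 1) continuous_const
    have h5 : Continuous fun u : ι → UnitaryMat n =>
        ((wordGrad i 1 w u)ᴴ * (Matrix.single a b 1)).trace :=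
      (h4.matrix_conjTranspose.mul continuous_const).matrix_trace
    fun_prop
  -- The entry (a, b) is paired with the direction E_ab.
  have h := Finset.sum_eq_zero fun a (_ : a ∈ Finset.univ) =>
    Finset.sum_eq_zero fun b (_ : b ∈ Finset.univ) =>
      integral_wordDeriv μ i w a b (Matrix.single a b 1)
  simp_rw [← integral_finsetSum Finset.univ fun b _ => integrable_of_continuous (hc _ b)] at h
  rw [← integral_finsetSum Finset.univ fun a _ => integrable_finsetSum _ fun b _ =>
    integrable_of_continuous (hc a b)] at h
  rw [← h]
  refine integral_congr_ae (Filter.Eventually.of_forall fun u => ?_)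
  simp only [Finset.sum_sub_distrib, ← Finset.sum_mul]
  congr 1
  · congr 1
    rw [← sum_mul_wordDeriv_apply]; simp only [one_mul]
  · rw [Matrix.trace_mul_comm]
    simp [Matrix.trace, Matrix.mul_apply, Matrix.single_apply, ite_and]

end Words

/-! ### Reduced words and their moment bounds -/

section Reduced

variable {n : ℕ} {ι : Type*}

/-- Either the coefficient after `x` is not the identity, or the letters of `x` and `y` are not
inverse to each other. -/
def NoCancel (x y : Atom ι n) : Prop := x.2.isSome ∨ ¬(x.1.1 = y.1.1 ∧ x.1.2 ≠ y.1.2)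

/-- Cyclically reduced words. -/
def CycReduced (w : List (Atom ι n)) : Prop :=
  w.IsChain NoCancel ∧ ∀ x ∈ w.getLast?, ∀ y ∈ w.head?, NoCancel x y

/-- The coefficients of `w` other than the identity are centered with moment bounds, and there are
at most `J` of them. -/
def WordBound (J : ℕ) (B : ℝ) (w : List (Atom ι n)) : Prop :=
  (∀ x ∈ w, ∀ A, x.2 = some A → ntr A = 0 ∧ MomentBound J B A) ∧
    w.countP (fun x => x.2.isSome) ≤ J

theorem WordBound.subperm {J : ℕ} {B : ℝ} {v w : List (Atom ι n)} (h : WordBound J B w)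
    (hv : v.Subperm w) : WordBound J B v :=
  ⟨fun x hx => h.1 x (hv.subset hx), (hv.countP_le _).trans h.2⟩

/-- Letters are unitary and cost nothing; each non-identity coefficient costs one Hölder step, hence
one level, with B unchanged. -/
theorem WordBound.momentBound {J : ℕ} {B : ℝ} (hB : 1 ≤ B) {w : List (Atom ι n)}
    (h : WordBound J B w) (u : ι → UnitaryMat n) :
    MomentBound (J - w.countP (fun x => x.2.isSome)) B (wordVal w u) := by
  induction w with
  | nil => exact momentBound_one _ hB
  | cons x w ih =>
    have h' := ih (h.subperm (List.sublist_cons_self x w).subperm)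
    have h2 := h.2
    rw [wordVal, mul_assoc]
    refine MomentBound.unitary_mul (letterVal_conjTranspose_mul_self _ _) ?_
    obtain ⟨z, a⟩ := x
    cases a with
    | none => simpa [coefVal] using h'
    | some A =>
      have hA := (h.1 _ List.mem_cons_self A rfl).2
      simp only [List.countP_cons, Option.isSome_some, if_true] at h2 ⊢
      refine MomentBound.mul (by linarith) (hA.mono (by omega) le_rfl)
        (h'.mono (by omega) le_rfl)

theorem WordBound.dyadicMoment_le {J : ℕ} {B : ℝ} (hB : 1 ≤ B) {w : List (Atom ι n)}
    (h : WordBound J B w) (u : ι → UnitaryMat n) : dyadicMoment 0 (wordVal w u) ≤ B :=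
  h.momentBound hB u 0 (Nat.zero_le _)

theorem WordBound.dyadicMoment_tail_le {J : ℕ} {B : ℝ} (hB : 1 ≤ B) {x : Atom ι n}
    {w : List (Atom ι n)} (h : WordBound J B (x :: w)) (u : ι → UnitaryMat n) :
    dyadicMoment 0 (coefVal x.2 * wordVal w u) ≤ B := by
  have := h.dyadicMoment_le hB u
  rwa [wordVal, mul_assoc, dyadicMoment_unitary_mul _ (letterVal_conjTranspose_mul_self _ _)]
    at this

theorem noCancel_of_letter_eq {x y z : Atom ι n} (h : NoCancel x y) (hyz : y.1 = z.1) :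
    NoCancel x z := by
  unfold NoCancel at *
  rwa [← hyz]

theorem isChain_append_singleton_of_letter_eq {v : List (Atom ι n)} {x y : Atom ι n}
    (h : (v ++ [x]).IsChain NoCancel) (hxy : x.1 = y.1) : (v ++ [y]).IsChain NoCancel := by
  rw [List.isChain_append] at h ⊢
  refine ⟨h.1, List.isChain_singleton y, fun p hp q hq => ?_⟩
  have := h.2.2 p hp x (by simp)
  obtain rfl : y = q := by simpa using hq
  exact noCancel_of_letter_eq this hxy

theorem norm_add_sq_le_two_mul (a b : ℂ) : ‖a + b‖ ^ 2 ≤ 2 * ‖a‖ ^ 2 + 2 * ‖b‖ ^ 2 := by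
  have h1 := pow_le_pow_left₀ (norm_nonneg _) (norm_add_le a b) 2
  nlinarith [sq_nonneg (‖a‖ - ‖b‖)]

theorem ntr_wordVal_of_cancel {p : Atom ι n} {v : List (Atom ι n)} {z : ι × Bool}
    (hz : z.1 = p.1.1 ∧ z.2 ≠ p.1.2) (u : ι → UnitaryMat n) :
    ntr (wordVal (p :: v ++ [(z, none)]) u) = ntr (coefVal p.2 * wordVal v u) := by
  have hz' : z = (p.1.1, !p.1.2) := Prod.ext hz.1 (Bool.eq_not_iff.2 hz.2)
  rw [wordVal_append, wordVal, wordVal, wordVal, ntr_mul_comm, hz', letterVal_not]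
  simp only [coefVal, Option.getD_none, mul_one, ← mul_assoc]
  rw [letterVal_conjTranspose_mul_self, one_mul]

/-- Only the junction from the last letter back to the first is in doubt. If it cancels, both end
letters drop out and the coefficient of p is left in front of v'. -/
theorem cycReduced_or_cancel {v : List (Atom ι n)} {z : ι × Bool}
    (h : (v ++ [(z, none)]).IsChain NoCancel) :
    CycReduced (v ++ [(z, none)]) ∨ ∃ (p : Atom ι n) (v' : List (Atom ι n)), v = p :: v' ∧
      (z.1 = p.1.1 ∧ z.2 ≠ p.1.2) ∧ v'.IsChain NoCancel ∧ (v' = [] → p.2.isSome) := by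
  by_cases hc : ∀ q ∈ (v ++ [(z, none)]).head?, NoCancel (z, none) q
  · refine Or.inl ⟨h, fun p hp q hq => ?_⟩
    obtain rfl : (z, none) = p := by simpa using hp
    exact hc q hq
  · right
    push Not at hc
    obtain ⟨q, hq, hzq⟩ := hc
    simp only [NoCancel, Option.isSome_none, Bool.false_eq_true, false_or, not_not] at hzq
    cases v with
    | nil =>
      obtain rfl : (z, none) = q := by simpa using hq
      exact absurd rfl hzq.2
    | cons p v' =>
      obtain rfl : p = q := by simpa using hq
      have h' := List.isChain_append.1 h
      refine ⟨p, v', rfl, hzq, h'.1.tail, ?_⟩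
      rintro rfl
      -- Here p stands directly before its inverse z, so reducedness forces a non-identity
      -- coefficient.
      rcases h'.2.2 p (by simp) (z, none) (by simp) with h1 | h1
      · exact h1
      · exact absurd ⟨hzq.1.symm, hzq.2.symm⟩ h1

theorem ntr_coefVal_eq_zero {J : ℕ} {B : ℝ} {x : Atom ι n} {w : List (Atom ι n)}
    (h : WordBound J B (x :: w)) (hx : x.2.isSome) : ntr (coefVal x.2) = 0 := by
  obtain ⟨A, hA⟩ := Option.isSome_iff_exists.1 hx
  rw [hA]
  exact (h.1 x List.mem_cons_self A hA).1

variable [Fintype ι]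

theorem integrable_norm_sq {μ : Measure (ι → UnitaryMat n)} [IsFiniteMeasure μ]
    {f : (ι → UnitaryMat n) → ℂ} (hf : Continuous f) : Integrable (fun u => ‖f u‖ ^ 2) μ :=
  integrable_of_continuous (by fun_prop)

theorem integral_norm_add_sq_le {μ : Measure (ι → UnitaryMat n)} [IsFiniteMeasure μ]
    {f g : (ι → UnitaryMat n) → ℂ} (hf : Continuous f) (hg : Continuous g) :
    ∫ u, ‖f u + g u‖ ^ 2 ∂μ ≤ 2 * ∫ u, ‖f u‖ ^ 2 ∂μ + 2 * ∫ u, ‖g u‖ ^ 2 ∂μ := by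
  rw [← integral_const_mul, ← integral_const_mul, ← integral_add
    ((integrable_norm_sq hf).const_mul _) ((integrable_norm_sq hg).const_mul _)]
  exact integral_mono (integrable_norm_sq (hf.add hg))
    (((integrable_norm_sq hf).const_mul _).add ((integrable_norm_sq hg).const_mul _))
    fun u => norm_add_sq_le_two_mul _ _

theorem integral_norm_mul_sq_le {μ : Measure (ι → UnitaryMat n)} [IsFiniteMeasure μ]
    {f g : (ι → UnitaryMat n) → ℂ} (hf : Continuous f) (hg : Continuous g) {B : ℝ}
    (hB : ∀ u, ‖g u‖ ^ 2 ≤ B) :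
    ∫ u, ‖f u * g u‖ ^ 2 ∂μ ≤ B * ∫ u, ‖f u‖ ^ 2 ∂μ := by
  rw [← integral_const_mul]
  refine integral_mono (integrable_norm_sq (hf.mul hg)) ((integrable_norm_sq hf).const_mul _)
    fun u => ?_
  simp only [norm_mul, mul_pow]
  rw [mul_comm]
  exact mul_le_mul_of_nonneg_right (hB u) (by positivity)

theorem continuous_ntr {X : Type*} [TopologicalSpace X] {f : X → Matrix (Fin n) (Fin n) ℂ}
    (hf : Continuous f) : Continuous fun x => ntr (f x) :=
  continuous_const.mul hf.matrix_trace

end Reduced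

/-! ### From cyclically reduced words to reduced words -/

section Decay

variable (ι : Type*) [Fintype ι]

/-- The second moments of traces of cyclically reduced words of length at most `k` are
`O(n⁻²)`. -/
def TraceDecay (k : ℕ) : Prop :=
  ∀ (J : ℕ) (B : ℝ), 1 ≤ B → ∃ C : ℝ, 0 ≤ C ∧ ∀ n : ℕ, n ≠ 0 →
    ∀ (μ : Measure (ι → UnitaryMat n)) [IsProbabilityMeasure μ] [μ.IsMulLeftInvariant]
      (w : List (Atom ι n)), w ≠ [] → w.length ≤ k → CycReduced w → WordBound J B w →
        ∫ u, ‖ntr (wordVal w u)‖ ^ 2 ∂μ ≤ C / (n : ℝ) ^ 2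

/-- The analogue of `TraceDecay` for words that are reduced, not necessarily cyclically, and that
have an additional coefficient in front. -/
def ChainDecay (k : ℕ) : Prop :=
  ∀ (J : ℕ) (B : ℝ), 1 ≤ B → ∃ C : ℝ, 0 ≤ C ∧ ∀ n : ℕ, n ≠ 0 →
    ∀ (μ : Measure (ι → UnitaryMat n)) [IsProbabilityMeasure μ] [μ.IsMulLeftInvariant]
      (x : Atom ι n) (w : List (Atom ι n)), w.length ≤ k → w.IsChain NoCancel →
        WordBound J B (x :: w) → (w = [] → x.2.isSome) →
          ∫ u, ‖ntr (coefVal x.2 * wordVal w u)‖ ^ 2 ∂μ ≤ C / (n : ℝ) ^ 2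

variable {ι}

theorem chainDecay_of_traceDecay {k : ℕ} (hk : TraceDecay ι k) :
    ∀ L ≤ k, ChainDecay ι L := by
  intro L
  induction L with
  | zero =>
    refine fun _ J B hB => ⟨0, le_rfl, fun n hn μ _ _ x w hw hc hb hx => ?_⟩
    obtain rfl : w = [] := List.length_eq_zero_iff.1 (by omega)
    simp [wordVal, ntr_coefVal_eq_zero hb (hx rfl)]
  | succ L ih =>
    intro hL J B hB
    have hB' : 1 ≤ (4 : ℝ) ^ 2 ^ J * B ^ 2 ^ J :=
      one_le_mul_of_one_le_of_one_le (one_le_pow₀ (by norm_num)) (one_le_pow₀ hB)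
    obtain ⟨C₁, hC₁, H₁⟩ := hk J B hB
    -- Used for the word with a merged, recentered coefficient: one level less and a larger bound.
    -- Hence J and B are quantified inside `TraceDecay`.
    obtain ⟨C₂, hC₂, H₂⟩ := hk (J - 1) (4 ^ 2 ^ J * B ^ 2 ^ J) hB'
    obtain ⟨C₃, hC₃, H₃⟩ := ih (by omega) J B hB
    have hCB : C₁ + C₃ ≤ B * (C₁ + C₃) := le_mul_of_one_le_left (by positivity) hB
    refine ⟨2 * C₂ + 2 * (B * (C₁ + C₃)), by positivity, fun n hn μ _ _ x w hw hc hb hx => ?_⟩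
    have hdiv : ∀ {c d : ℝ}, c ≤ d → c / (n : ℝ) ^ 2 ≤ d / (n : ℝ) ^ 2 :=
      fun h => div_le_div_of_nonneg_right h (by positivity)
    rcases List.eq_nil_or_concat w with rfl | ⟨v, ⟨z, c⟩, rfl⟩
    · simp only [wordVal, mul_one, ntr_coefVal_eq_zero hb (hx rfl), norm_zero, ne_eq,
        OfNat.ofNat_ne_zero, not_false_eq_true, zero_pow, integral_zero]
      positivity
    rw [List.concat_eq_append] at hw hc hb ⊢
    obtain ⟨y, a⟩ := x
    simp only [List.length_append, List.length_singleton] at hw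
    have hbv : WordBound J B (v ++ [(z, c)]) := hb.subperm (List.sublist_cons_self _ _).subperm
    -- With the last coefficient erased the ends may cancel; the shorter chain is then covered by
    -- the inner induction.
    have hnone : ∫ u, ‖ntr (wordVal (v ++ [(z, none)]) u)‖ ^ 2 ∂μ ≤ (C₁ + C₃) / (n : ℝ) ^ 2 := by
      have hcn : (v ++ [(z, none)]).IsChain NoCancel :=
        isChain_append_singleton_of_letter_eq hc rfl
      have hbn : WordBound J B (v ++ [(z, none)]) := by
        refine ⟨fun p hp A hA => ?_, le_trans ?_ hbv.2⟩
        · rcases List.mem_append.1 hp with h | h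
          · exact hbv.1 p (List.mem_append_left _ h) A hA
          · obtain rfl : p = (z, none) := by simpa using h
            simp at hA
        · simp [List.countP_append]
      rcases cycReduced_or_cancel hcn with hred | ⟨p, v', rfl, hz, hv', hp⟩
      · exact (H₁ n hn μ _ (by simp) (by simp; omega) hred hbn).trans (hdiv (by linarith))
      · simp only [ntr_wordVal_of_cancel hz]
        refine (H₃ n hn μ p v' ?_ hv' ?_ hp).trans (hdiv (by linarith))
        · simp only [List.length_cons] at hw; omega
        · exact hbv.subperm (List.sublist_append_left _ _).subperm
    have hcyc : ∀ u, ntr (coefVal a * wordVal (v ++ [(z, c)]) u) =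
        ntr (wordVal v u * letterVal z u * (coefVal c * coefVal a)) := by
      intro u
      rw [ntr_mul_comm, wordVal_append, wordVal, wordVal]
      simp only [mul_one, mul_assoc]
    simp only [hcyc]
    -- A non-identity last coefficient blocks cancellation around the cycle.
    have hlast : ∀ A : Matrix (Fin n) (Fin n) ℂ, CycReduced (v ++ [(z, some A)]) := by
      refine fun A => ⟨isChain_append_singleton_of_letter_eq hc rfl, fun p hp q _ => ?_⟩
      obtain rfl : (z, some A) = p := by simpa using hp
      exact Or.inl rfl
    have hval : ∀ (d : Option (Matrix (Fin n) (Fin n) ℂ)) u,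
        wordVal v u * letterVal z u * coefVal d = wordVal (v ++ [(z, d)]) u := by
      intro d u
      rw [wordVal_append, wordVal, wordVal]
      simp only [mul_one, mul_assoc]
    cases a with
    | none =>
      simp only [coefVal, Option.getD_none, mul_one]
      cases c with
      | none =>
        have := hval none
        simp only [coefVal, Option.getD_none] at this ⊢
        simp only [this]
        exact hnone.trans (hdiv (by linarith))
      | some A =>
        have := hval (some A)
        simp only [coefVal] at this
        simp only [this]
        exact (H₁ n hn μ _ (by simp) (by simp; omega) (hlast A) hbv).trans (hdiv (by linarith))
    | some A =>
      cases c with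
      | none =>
        have := hval (some A)
        simp only [coefVal] at this
        simp only [coefVal, Option.getD_none, one_mul]
        simp only [this]
        refine (H₁ n hn μ _ (by simp) (by simp; omega) (hlast A) ?_).trans (hdiv (by linarith))
        refine ⟨fun p hp A' hA' => ?_, le_trans (le_of_eq ?_) hb.2⟩
        · rcases List.mem_append.1 hp with h | h
          · exact hbv.1 p (List.mem_append_left _ h) A' hA'
          · obtain rfl : p = (z, some A) := by simpa using h
            exact hb.1 (y, some A) List.mem_cons_self A' hA'
        · simp [List.countP_append]
      | some A' =>
        have hJ := hb.2
        simp only [List.countP_append, List.countP_cons, Option.isSome_some, if_true,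
          List.countP_nil] at hJ
        have hA := (hb.1 (y, some A) List.mem_cons_self A rfl).2
        have hA' := (hbv.1 (z, some A') (by simp) A' rfl).2
        -- Merging loses a level, but the number of coefficients also drops by one, so J - 1
        -- suffices.
        have hAA : MomentBound (J - 1) B (A' * A) :=
          MomentBound.mul (by linarith) (hA'.mono (by omega) le_rfl) (hA.mono (by omega) le_rfl)
        have hpow : B ≤ B ^ 2 ^ J := le_self_pow₀ hB (by positivity)
        have hBB : B ≤ 4 ^ 2 ^ J * B ^ 2 ^ J :=
          hpow.trans (le_mul_of_one_le_left (by positivity) (one_le_pow₀ (by norm_num)))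
        have hcent : MomentBound (J - 1) (4 ^ 2 ^ J * B ^ 2 ^ J) (centered (A' * A)) := by
          refine (hAA.centered hB).mono le_rfl ?_
          have h2 : 2 ^ (J - 1) ≤ 2 ^ J := Nat.pow_le_pow_right (by norm_num) (by omega)
          exact mul_le_mul (pow_le_pow_right₀ (by norm_num) h2) (pow_le_pow_right₀ hB h2)
            (by positivity) (by positivity)
        have hsplit : ∀ u, ntr (wordVal v u * letterVal z u *
              (coefVal (some A') * coefVal (some A))) =
            ntr (wordVal (v ++ [(z, some (centered (A' * A)))]) u) +
              ntr (wordVal (v ++ [(z, none)]) u) * ntr (A' * A) := by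
          intro u
          rw [← hval, ← hval]
          simp only [coefVal, Option.getD_some, Option.getD_none, centered, mul_add,
            Matrix.mul_smul, mul_one, ntr_add, ntr_smul]
          ring
        simp only [hsplit]
        have h1 : Continuous fun u : ι → UnitaryMat n =>
            ntr (wordVal (v ++ [(z, some (centered (A' * A)))]) u) :=
          continuous_ntr (continuous_wordVal _)
        have h2 : Continuous fun u : ι → UnitaryMat n =>
            ntr (wordVal (v ++ [(z, none)]) u) :=
          continuous_ntr (continuous_wordVal _)
        have hm : Continuous fun u : ι → UnitaryMat n =>
            ntr (wordVal (v ++ [(z, none)]) u) * ntr (A' * A) := h2.mul continuous_const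
        refine (integral_norm_add_sq_le h1 hm).trans ?_
        have h3 := integral_norm_mul_sq_le (μ := μ) h2 (g := fun _ => ntr (A' * A))
          continuous_const (fun _ => hAA.norm_ntr_sq_le)
        have h4 := H₂ n hn μ (v ++ [(z, some (centered (A' * A)))]) (by simp) (by simp; omega)
          (hlast _) ?_
        · have h5 := mul_le_mul_of_nonneg_left hnone (by linarith : (0 : ℝ) ≤ B)
          calc _ ≤ 2 * (C₂ / (n : ℝ) ^ 2) + 2 * (B * ((C₁ + C₃) / (n : ℝ) ^ 2)) := by linarith
            _ = _ := by ring
        · refine ⟨fun p hp A'' hA'' => ?_, ?_⟩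
          · rcases List.mem_append.1 hp with h | h
            · have := hbv.1 p (List.mem_append_left _ h) A'' hA''
              exact ⟨this.1, this.2.mono (by omega) hBB⟩
            · obtain rfl : p = (z, some (centered (A' * A))) := by simpa using h
              obtain rfl : centered (A' * A) = A'' := by simpa using hA''
              exact ⟨ntr_centered hn _, hcent⟩
          · simp only [List.countP_append, List.countP_cons, Option.isSome_some, if_true,
              List.countP_nil]
            omega

end Decay

/-! ### Second-moment estimate from the Schwinger–Dyson equation -/

section Induction

variable {n : ℕ} {ι : Type*}

theorem dyadicMoment_neg (j : ℕ) (A : Matrix (Fin n) (Fin n) ℂ) :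
    dyadicMoment j (-A) = dyadicMoment j A := by
  rw [dyadicMoment, dyadicMoment, conjTranspose_neg, neg_mul_neg]

theorem wordBound_cons_append {J : ℕ} {B : ℝ} {x : Atom ι n} {pre r : List (Atom ι n)}
    (h : WordBound J B (pre ++ x :: r)) : WordBound J B ((x :: r) ++ pre) :=
  h.subperm List.perm_append_comm.subperm

/-- Up to sign and unitary factors, each nonzero summand is a cyclic rotation of the word, so its
moment is at most B. Adding a summand costs at most a factor 4. -/
theorem dyadicMoment_wordGrad_le [DecidableEq ι] {J : ℕ} {B : ℝ} (hB : 1 ≤ B) (i : ι)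
    (u : ι → UnitaryMat n) (r : List (Atom ι n)) : ∀ pre : List (Atom ι n),
    WordBound J B (pre ++ r) → dyadicMoment 0 (wordGrad i (wordVal pre u) r u) ≤
      4 ^ r.length * B := by
  induction r with
  | nil => intro pre _; simp [wordGrad, dyadicMoment_zero]; linarith
  | cons x r ih =>
    intro pre hb
    have hb' := wordBound_cons_append hb
    have h1 := hb'.dyadicMoment_le hB u
    have h2 := ih (pre ++ [x]) (by simpa using hb)
    have e : wordVal (pre ++ [x]) u = wordVal pre u * (letterVal x.1 u * coefVal x.2) := by
      simp [wordVal_append, wordVal]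
    rw [e] at h2
    rw [wordGrad]
    refine (dyadicMoment_zero_add_le _ _).trans ?_
    have h3 : dyadicMoment 0 (if x.1.1 = i then
      (if x.1.2 then wordVal (x :: r) u * wordVal pre u
        else -(coefVal x.2 * wordVal r u * wordVal pre u * letterVal x.1 u))
      else 0) ≤ B := by
      split_ifs
      · rwa [← wordVal_append]
      · rw [dyadicMoment_neg, dyadicMoment_mul_unitary _ (letterVal_mul_conjTranspose_self _ _),
          mul_assoc, ← wordVal_append]
        exact WordBound.dyadicMoment_tail_le hB hb' u
      · simp [dyadicMoment_zero]; linarith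
    have h4 : 1 * B ≤ 4 ^ r.length * B :=
      mul_le_mul_of_nonneg_right (one_le_pow₀ (by norm_num)) (by linarith)
    rw [List.length_cons, pow_succ]
    linarith

theorem norm_ntr_mul_sq_le_of_le {A B : Matrix (Fin n) (Fin n) ℂ} {a b : ℝ} (ha : 0 ≤ a)
    (hA : dyadicMoment 0 A ≤ a) (hB : dyadicMoment 0 B ≤ b) : ‖ntr (A * B)‖ ^ 2 ≤ a * b :=
  (norm_ntr_mul_sq_le A B).trans (mul_le_mul hA hB (dyadicMoment_nonneg _ _) ha)

variable [Fintype ι] [DecidableEq ι]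

/-- In every product of traces the factor containing the start of the word decays, by `H₁` or `H₂`
according to the sign of the splitting letter; the other is bounded by B in square. The recursion
over r moves letters into p. -/
theorem integral_norm_wordSplit_sq_le {k J : ℕ} {B C₁ C₂ : ℝ} (hB : 1 ≤ B) (hC₁ : 0 ≤ C₁)
    (hC₂ : 0 ≤ C₂) (hn : n ≠ 0) (μ : Measure (ι → UnitaryMat n)) [IsProbabilityMeasure μ]
    (H₁ : ∀ w : List (Atom ι n), w ≠ [] → w.length ≤ k → CycReduced w → WordBound J B w →
      ∫ u, ‖ntr (wordVal w u)‖ ^ 2 ∂μ ≤ C₁ / (n : ℝ) ^ 2)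
    (H₂ : ∀ (x : Atom ι n) (w : List (Atom ι n)), w.length ≤ k → w.IsChain NoCancel →
      WordBound J B (x :: w) → (w = [] → x.2.isSome) →
        ∫ u, ‖ntr (coefVal x.2 * wordVal w u)‖ ^ 2 ∂μ ≤ C₂ / (n : ℝ) ^ 2)
    (i : ι) (a : Option (Matrix (Fin n) (Fin n) ℂ)) (r : List (Atom ι n)) :
    ∀ p : List (Atom ι n), (((i, true), a) :: p ++ r).length ≤ k + 1 →
      (((i, true), a) :: p ++ r).IsChain NoCancel → WordBound J B (((i, true), a) :: p ++ r) →
        ∫ u, ‖((n : ℂ)⁻¹) ^ 2 * wordSplit i (wordVal (((i, true), a) :: p) u) r u‖ ^ 2 ∂μ ≤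
          4 ^ r.length * (B * (C₁ + C₂)) / (n : ℝ) ^ 2 := by
  induction r with
  | nil =>
    intro p _ _ _
    simp only [wordSplit, mul_zero, norm_zero, ne_eq, OfNat.ofNat_ne_zero, not_false_eq_true,
      zero_pow, integral_zero]
    positivity
  | cons x r ih =>
    intro p hl hc hb
    obtain ⟨q, hq⟩ : ∃ q, q = ((i, true), a) :: p := ⟨_, rfl⟩
    have e : ((i, true), a) :: p ++ x :: r = ((i, true), a) :: (p ++ [x]) ++ r := by simp
    have h2 := ih (p ++ [x]) (by rwa [← e]) (by rwa [← e]) (by rwa [← e])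
    have e2 : ∀ u, wordVal (((i, true), a) :: (p ++ [x])) u =
        wordVal (((i, true), a) :: p) u * (letterVal x.1 u * coefVal x.2) := by
      intro u
      rw [← List.cons_append, wordVal_append]
      simp [wordVal]
    simp only [e2] at h2
    rw [← hq] at hl hc hb h2 ⊢
    simp only [List.length_append, List.length_cons] at hl
    have hxr : WordBound J B (x :: r) := hb.subperm (List.sublist_append_right _ _).subperm
    have hqb : WordBound J B q := hb.subperm (List.sublist_append_left _ _).subperm
    have hchain := List.isChain_append.1 hc
    have hCC : 0 ≤ C₁ + C₂ := by linarith
    have hterm : ∫ u, ‖((n : ℂ)⁻¹) ^ 2 * (if x.1.1 = i then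
        (if x.1.2 then (wordVal q u).trace * (wordVal (x :: r) u).trace
          else -((wordVal q u * letterVal x.1 u).trace * (coefVal x.2 * wordVal r u).trace))
        else 0)‖ ^ 2 ∂μ ≤ B * (C₁ + C₂) / (n : ℝ) ^ 2 := by
      split_ifs with hi hs
      · have e3 : ∀ u, ((n : ℂ)⁻¹) ^ 2 * ((wordVal q u).trace * (wordVal (x :: r) u).trace) =
            ntr (wordVal q u) * ntr (wordVal (x :: r) u) := by
          intro u; simp only [ntr]; ring
        simp only [e3]
        refine (integral_norm_mul_sq_le (continuous_ntr (continuous_wordVal _))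
          (continuous_ntr (continuous_wordVal _)) (B := B)
          fun u => (norm_ntr_sq_le _).trans (hxr.dyadicMoment_le hB u)).trans ?_
        have h3 := H₁ q (by simp [hq]) (by omega) ?_ hqb
        · rw [mul_div_assoc]
          refine mul_le_mul_of_nonneg_left (h3.trans ?_) (by linarith)
          exact div_le_div_of_nonneg_right (by linarith) (by positivity)
        -- The letter of x equals the first letter of q, so non-cancellation before x closes q into
        -- a cycle.
        · refine ⟨hchain.1, fun y hy z hz => ?_⟩
          have h4 := hchain.2.2 y hy x (by simp)
          have hz' : ((i, true), a) = z := by simpa [hq] using hz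
          exact noCancel_of_letter_eq h4 (by rw [← hz']; exact Prod.ext hi hs)
      · have hx1 : x.1 = (i, !true) := Prod.ext hi (by simpa using hs)
        have e3 : ∀ u, ((n : ℂ)⁻¹) ^ 2 * -((wordVal q u * letterVal x.1 u).trace *
              (coefVal x.2 * wordVal r u).trace) =
            ntr (coefVal a * wordVal p u) * -ntr (coefVal x.2 * wordVal r u) := by
          intro u
          have e4 : (wordVal q u * letterVal x.1 u).trace = (coefVal a * wordVal p u).trace := by
            rw [hq, hx1, letterVal_not, Matrix.trace_mul_comm, wordVal]
            simp only [← mul_assoc]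
            rw [letterVal_conjTranspose_mul_self, one_mul]
          rw [e4]
          simp only [ntr]; ring
        simp only [e3]
        refine (integral_norm_mul_sq_le
          (continuous_ntr (continuous_const.mul (continuous_wordVal _)))
          (continuous_ntr (continuous_const.mul (continuous_wordVal _))).neg (B := B)
          fun u => ?_).trans ?_
        · have h4 := (norm_ntr_sq_le _).trans (hxr.dyadicMoment_tail_le hB u)
          rw [← norm_neg] at h4
          exact h4
        · rw [hq] at hqb hchain hl
          have h3 := H₂ ((i, true), a) p (by simp only [List.length_cons] at hl; omega)
            hchain.1.tail hqb ?_
          · rw [mul_div_assoc]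
            refine mul_le_mul_of_nonneg_left (h3.trans ?_) (by linarith)
            exact div_le_div_of_nonneg_right (by linarith) (by positivity)
          -- With p empty, u_i is followed by its inverse, so a cannot be the identity.
          · rintro rfl
            rcases hchain.2.2 ((i, true), a) (by simp) x (by simp) with h | h
            · exact h
            · exact absurd ⟨hi.symm, by simpa using hs⟩ h
      · simp only [mul_zero, norm_zero, ne_eq, OfNat.ofNat_ne_zero, not_false_eq_true,
          zero_pow, integral_zero]
        positivity
    simp only [wordSplit, mul_add]
    have hcont1 : Continuous fun u : ι → UnitaryMat n => ((n : ℂ)⁻¹) ^ 2 * (if x.1.1 = i then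
        (if x.1.2 then (wordVal q u).trace * (wordVal (x :: r) u).trace
          else -((wordVal q u * letterVal x.1 u).trace * (coefVal x.2 * wordVal r u).trace))
        else 0) := by
      refine continuous_const.mul ?_
      split_ifs
      · exact (continuous_wordVal q).matrix_trace.mul (continuous_wordVal _).matrix_trace
      · exact (((continuous_wordVal q).mul (continuous_letterVal _)).matrix_trace.mul
          (continuous_const.mul (continuous_wordVal r)).matrix_trace).neg
      · exact continuous_const
    have hcont2 : Continuous fun u : ι → UnitaryMat n => ((n : ℂ)⁻¹) ^ 2 *
        wordSplit i (wordVal q u * (letterVal x.1 u * coefVal x.2)) r u :=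
      continuous_const.mul (continuous_wordSplit i r (by fun_prop))
    refine (integral_norm_add_sq_le hcont1 hcont2).trans ?_
    have h5 : 1 * (B * (C₁ + C₂)) ≤ 4 ^ r.length * (B * (C₁ + C₂)) :=
      mul_le_mul_of_nonneg_right (one_le_pow₀ (by norm_num))
        (mul_nonneg (by linarith) hCC)
    have h6 : B * (C₁ + C₂) / (n : ℝ) ^ 2 ≤ 4 ^ r.length * (B * (C₁ + C₂)) / (n : ℝ) ^ 2 :=
      div_le_div_of_nonneg_right (by linarith) (by positivity)
    calc _ ≤ 4 * (4 ^ r.length * (B * (C₁ + C₂)) / (n : ℝ) ^ 2) := by linarith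
      _ = _ := by rw [List.length_cons, pow_succ]; ring

/-- Consequence of the Schwinger–Dyson equation for a word that begins with the letter `u i`. -/
theorem integral_norm_ntr_sq_le {J k : ℕ} {B D : ℝ} (hB : 1 ≤ B) (hn : n ≠ 0)
    (μ : Measure (ι → UnitaryMat n)) [IsProbabilityMeasure μ] [μ.IsMulLeftInvariant]
    (i : ι) (a : Option (Matrix (Fin n) (Fin n) ℂ)) (t : List (Atom ι n)) (ht : t.length ≤ k)
    (hb : WordBound J B (((i, true), a) :: t))
    (hD : ∫ u, ‖((n : ℂ)⁻¹) ^ 2 * wordSplit i (wordVal [((i, true), a)] u) t u‖ ^ 2 ∂μ ≤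
      D / (n : ℝ) ^ 2) :
    ∫ u, ‖ntr (wordVal (((i, true), a) :: t) u)‖ ^ 2 ∂μ ≤
      (D + 2 * (4 ^ (k + 1) * B)) / (n : ℝ) ^ 2 := by
  obtain ⟨w, hw⟩ : ∃ w, w = ((i, true), a) :: t := ⟨_, rfl⟩
  rw [← hw] at hb ⊢
  have hn' : (n : ℂ) ≠ 0 := by exact_mod_cast hn
  set T : (ι → UnitaryMat n) → ℂ := fun u => ntr (wordVal w u) with hT
  set Q : (ι → UnitaryMat n) → ℂ :=
    fun u => ((n : ℂ)⁻¹) ^ 2 * wordSplit i (wordVal [((i, true), a)] u) t u with hQ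
  set R : (ι → UnitaryMat n) → ℂ := fun u => ntr ((wordGrad i 1 w u)ᴴ * wordVal w u) with hR
  have hTc : Continuous T := continuous_ntr (continuous_wordVal w)
  have hQc : Continuous Q := continuous_const.mul (continuous_wordSplit i t (continuous_wordVal _))
  have hRc : Continuous R := by
    have h4 : Continuous fun u : ι → UnitaryMat n => wordGrad i 1 w u :=
      continuous_wordGrad i w (P := fun _ => 1) continuous_const
    exact continuous_ntr (h4.matrix_conjTranspose.mul (continuous_wordVal w))
  have hRb : ∀ u, ‖R u‖ ≤ 4 ^ (k + 1) * B := by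
    intro u
    have h1 : dyadicMoment 0 (wordGrad i 1 w u)ᴴ ≤ 4 ^ (k + 1) * B := by
      rw [dyadicMoment_conjTranspose]
      refine (dyadicMoment_wordGrad_le hB i u w [] hb).trans ?_
      refine mul_le_mul_of_nonneg_right (pow_le_pow_right₀ (by norm_num) ?_) (by linarith)
      rw [hw, List.length_cons]; omega
    have h2 : dyadicMoment 0 (wordVal w u) ≤ 4 ^ (k + 1) * B :=
      (hb.dyadicMoment_le hB u).trans
        (le_mul_of_one_le_left (by linarith) (one_le_pow₀ (by norm_num)))
    have h3 := norm_ntr_mul_sq_le_of_le (by positivity) h1 h2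
    rw [← pow_two] at h3
    exact le_of_sq_le_sq h3 (by positivity)
  have key : ∫ u, (T u * star (T u) + Q u * star (T u) - ((n : ℂ)⁻¹) ^ 2 * R u) ∂μ = 0 := by
    have h := integral_wordSplit_mul_star_trace μ i w
    have e : ∀ u, T u * star (T u) + Q u * star (T u) - ((n : ℂ)⁻¹) ^ 2 * R u =
        ((n : ℂ)⁻¹) ^ 3 * (wordSplit i 1 w u * star (wordVal w u).trace -
          ((wordGrad i 1 w u)ᴴ * wordVal w u).trace) := by
      intro u
      -- Splitting at the first letter gives Tr(1) Tr(w): this factor n makes E|T|² the leading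
      -- term.
      have e1 : wordSplit i 1 w u = n * (wordVal w u).trace +
          wordSplit i (wordVal [((i, true), a)] u) t u := by
        rw [hw, wordSplit]
        simp [wordVal]
      rw [e1]
      simp only [hT, hQ, hR, ntr, star_mul', star_inv₀, star_natCast]
      field_simp
    simp only [e]
    rw [integral_const_mul, h, mul_zero]
  have keyre : ∫ u, (T u * star (T u) + Q u * star (T u) - ((n : ℂ)⁻¹) ^ 2 * R u).re ∂μ = 0 := by
    have hi : Integrable (fun u => T u * star (T u) + Q u * star (T u) -
        ((n : ℂ)⁻¹) ^ 2 * R u) μ := integrable_of_continuous (by fun_prop)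
    have := integral_re hi
    rw [key] at this
    simpa using this
  -- |Q||T| ≤ (|Q|² + |T|²)/2; the half of |T|² is absorbed on the left after integration.
  have hpt : ∀ u, ‖T u‖ ^ 2 ≤ (T u * star (T u) + Q u * star (T u) - ((n : ℂ)⁻¹) ^ 2 * R u).re +
      ((1 / 2) * ‖Q u‖ ^ 2 + (1 / 2) * ‖T u‖ ^ 2 + 4 ^ (k + 1) * B / (n : ℝ) ^ 2) := by
    intro u
    have h1 : (T u * star (T u)).re = ‖T u‖ ^ 2 := by
      have : T u * star (T u) = ((‖T u‖ ^ 2 : ℝ) : ℂ) := by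
        rw [Complex.ofReal_pow]; exact Complex.mul_conj' (T u)
      rw [this, Complex.ofReal_re]
    have h2 : -(Q u * star (T u)).re ≤ ‖Q u‖ * ‖T u‖ := by
      have := (abs_le.1 (Complex.abs_re_le_norm (Q u * star (T u)))).1
      rw [norm_mul, norm_star] at this
      linarith
    have h3 : (((n : ℂ)⁻¹) ^ 2 * R u).re ≤ 4 ^ (k + 1) * B / (n : ℝ) ^ 2 := by
      refine (Complex.re_le_norm _).trans ?_
      rw [norm_mul, norm_pow, norm_inv, Complex.norm_natCast, inv_pow, div_eq_inv_mul]
      exact mul_le_mul_of_nonneg_left (hRb u) (by positivity)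
    rw [Complex.sub_re, Complex.add_re, h1]
    nlinarith [sq_nonneg (‖Q u‖ - ‖T u‖)]
  have hi1 : Integrable (fun u => (T u * star (T u) + Q u * star (T u) -
      ((n : ℂ)⁻¹) ^ 2 * R u).re) μ := integrable_of_continuous (by fun_prop)
  have hi2 : Integrable (fun u => (1 / 2) * ‖Q u‖ ^ 2) μ := (integrable_norm_sq hQc).const_mul _
  have hi3 : Integrable (fun u => (1 / 2) * ‖T u‖ ^ 2) μ := (integrable_norm_sq hTc).const_mul _
  have hi23 : Integrable (fun u => (1 / 2) * ‖Q u‖ ^ 2 + (1 / 2) * ‖T u‖ ^ 2) μ := hi2.add hi3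
  have hi4 : Integrable (fun u => (1 / 2) * ‖Q u‖ ^ 2 + (1 / 2) * ‖T u‖ ^ 2 +
      4 ^ (k + 1) * B / (n : ℝ) ^ 2) μ := hi23.add (integrable_const _)
  have hint := integral_mono (integrable_norm_sq (μ := μ) hTc) (hi1.add hi4) hpt
  simp only [Pi.add_apply] at hint
  rw [integral_add hi1 hi4, keyre, integral_add hi23 (integrable_const _), integral_add hi2 hi3,
    integral_const_mul, integral_const_mul, integral_const, probReal_univ, one_smul] at hint
  have : (D + 2 * (4 ^ (k + 1) * B)) / (n : ℝ) ^ 2 =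
      D / (n : ℝ) ^ 2 + 2 * (4 ^ (k + 1) * B / (n : ℝ) ^ 2) := by ring
  rw [this]
  linarith

/-- Replacing every letter of a word by its inverse. -/
def flipWord (w : List (Atom ι n)) : List (Atom ι n) := w.map fun x => ((x.1.1, !x.1.2), x.2)

end Induction

/-! ### Inverting all letters, and the induction on length -/

section Flip

variable {n : ℕ} {ι : Type*}

theorem wordVal_flipWord (w : List (Atom ι n)) (u : ι → UnitaryMat n) :
    wordVal (flipWord w) u = wordVal w u⁻¹ := by
  induction w with
  | nil => rfl
  | cons x w ih =>
    rw [flipWord] at ih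
    rw [flipWord, List.map_cons, wordVal, wordVal, ih, letterVal_not]
    congr 2
    unfold letterVal
    split_ifs
    · rfl
    · rw [conjTranspose_conjTranspose, Pi.inv_apply]
      change _ = (star ((star (u x.1.1) : UnitaryMat n) : Matrix (Fin n) (Fin n) ℂ))
      simp

theorem noCancel_flip {x y : Atom ι n} (h : NoCancel x y) :
    NoCancel ((x.1.1, !x.1.2), x.2) ((y.1.1, !y.1.2), y.2) := by
  simpa [NoCancel] using h

theorem CycReduced.flipWord {w : List (Atom ι n)} (h : CycReduced w) :
    CycReduced (flipWord w) := by
  refine ⟨?_, ?_⟩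
  · rw [_root_.flipWord, List.isChain_map]
    exact h.1.imp fun _ _ => noCancel_flip
  · intro x hx y hy
    simp only [_root_.flipWord, List.getLast?_map, List.head?_map, Option.mem_map] at hx hy
    obtain ⟨x', hx', rfl⟩ := hx
    obtain ⟨y', hy', rfl⟩ := hy
    exact noCancel_flip (h.2 x' hx' y' hy')

theorem WordBound.flipWord {J : ℕ} {B : ℝ} {w : List (Atom ι n)} (h : WordBound J B w) :
    WordBound J B (flipWord w) := by
  refine ⟨fun x hx A hA => ?_, ?_⟩
  · obtain ⟨y, hy, rfl⟩ := List.mem_map.1 hx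
    exact h.1 y hy A hA
  · rw [_root_.flipWord, List.countP_map]
    exact h.2

variable [Fintype ι]

theorem traceDecay (k : ℕ) : TraceDecay ι k := by
  classical
  induction k with
  | zero =>
    refine fun J B _ => ⟨0, le_rfl, fun n _ μ _ _ w hw hl _ _ => ?_⟩
    exact absurd (List.length_eq_zero_iff.1 (by omega)) hw
  | succ k ih =>
    intro J B hB
    obtain ⟨C₁, hC₁, H₁⟩ := ih J B hB
    obtain ⟨C₂, hC₂, H₂⟩ := chainDecay_of_traceDecay ih k le_rfl J B hB
    refine ⟨4 ^ k * (B * (C₁ + C₂)) + 2 * (4 ^ (k + 1) * B), by positivity,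
      fun n hn μ _ _ w hw hl hr hb => ?_⟩
    have hpos : ∀ (i : ι) (a : Option (Matrix (Fin n) (Fin n) ℂ)) (t : List (Atom ι n)),
        t.length ≤ k → CycReduced (((i, true), a) :: t) → WordBound J B (((i, true), a) :: t) →
        ∫ u, ‖ntr (wordVal (((i, true), a) :: t) u)‖ ^ 2 ∂μ ≤
          (4 ^ k * (B * (C₁ + C₂)) + 2 * (4 ^ (k + 1) * B)) / (n : ℝ) ^ 2 := by
      intro i a t ht hr hb
      refine integral_norm_ntr_sq_le hB hn μ i a t ht hb ?_
      refine (integral_norm_wordSplit_sq_le hB hC₁ hC₂ hn μ (H₁ n hn μ) (H₂ n hn μ) i a t []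
        (by simpa using ht) hr.1 hb).trans ?_
      refine div_le_div_of_nonneg_right ?_ (by positivity)
      exact mul_le_mul_of_nonneg_right (pow_le_pow_right₀ (by norm_num) ht) (by positivity)
    obtain ⟨⟨⟨i, b⟩, a⟩, t, rfl⟩ := List.exists_cons_of_ne_nil hw
    simp only [List.length_cons] at hl
    cases b with
    | true => exact hpos i a t (by omega) hr hb
    | false =>
      -- Inverting every letter makes the first one positive and preserves the integral.
      have hf := hpos i a (flipWord t) (by simp [flipWord]; omega) hr.flipWord hb.flipWord
      have e : ((i, true), a) :: flipWord t = flipWord (((i, false), a) :: t) := rfl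
      rw [e] at hf
      simp only [wordVal_flipWord] at hf
      have hc : Continuous fun u : ι → UnitaryMat n =>
          ‖ntr (wordVal (((i, false), a) :: t) u)‖ ^ 2 :=
        ((continuous_ntr (continuous_wordVal _)).norm).pow 2
      rwa [integral_inv_eq_of_continuous μ hc] at hf

end Flip

/-! ### Expanding integer powers into letters -/

section Blocks

variable {n : ℕ} {ι : Type*}

/-- The word `u i ^ e A` for `e ≠ 0`. -/
def powerBlock (i : ι) (e : ℤ) (a : Option (Matrix (Fin n) (Fin n) ℂ)) : List (Atom ι n) :=
  List.replicate (e.natAbs - 1) ((i, decide (0 < e)), none) ++ [((i, decide (0 < e)), a)]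

theorem wordVal_replicate (x : ι × Bool) (q : ℕ) (u : ι → UnitaryMat n) :
    wordVal (List.replicate q (x, none)) u = letterVal x u ^ q := by
  induction q with
  | zero => rfl
  | succ q ih =>
    rw [List.replicate_succ, wordVal, ih, coefVal, Option.getD_none, mul_one, pow_succ']

theorem letterVal_pow_natAbs (i : ι) {e : ℤ} (he : e ≠ 0) (u : ι → UnitaryMat n) :
    letterVal (i, decide (0 < e)) u ^ e.natAbs = ((u i ^ e : UnitaryMat n) :
      Matrix (Fin n) (Fin n) ℂ) := by
  obtain ⟨q, rfl | rfl⟩ := e.eq_nat_or_neg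
  · have : (0 : ℤ) < q := by omega
    have hq : 0 < q := by omega
    simp [letterVal, hq]
  · have : ¬ (0 : ℤ) < -q := by omega
    rw [_root_.zpow_neg, zpow_natCast, ← inv_pow, SubmonoidClass.coe_pow]
    simp [letterVal, star_eq_conjTranspose]

theorem wordVal_powerBlock (i : ι) {e : ℤ} (he : e ≠ 0)
    (a : Option (Matrix (Fin n) (Fin n) ℂ)) (u : ι → UnitaryMat n) :
    wordVal (powerBlock i e a) u =
      ((u i ^ e : UnitaryMat n) : Matrix (Fin n) (Fin n) ℂ) * coefVal a := by
  have h : e.natAbs - 1 + 1 = e.natAbs := by omega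
  rw [powerBlock, wordVal_append, wordVal_replicate, wordVal, wordVal, mul_one, ← mul_assoc,
    ← pow_succ, h, letterVal_pow_natAbs i he]

theorem length_powerBlock (i : ι) {e : ℤ} (he : e ≠ 0)
    (a : Option (Matrix (Fin n) (Fin n) ℂ)) : (powerBlock i e a).length = e.natAbs := by
  simp [powerBlock]; omega

theorem countP_powerBlock_le (i : ι) (e : ℤ) (a : Option (Matrix (Fin n) (Fin n) ℂ)) :
    (powerBlock i e a).countP (fun x => x.2.isSome) ≤ 1 := by
  rw [powerBlock, List.countP_append, List.countP_replicate]
  simpa using List.countP_le_length (p := fun x : Atom ι n => x.2.isSome)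
    (l := [((i, decide (0 < e)), a)])

theorem fst_of_mem_powerBlock {i : ι} {e : ℤ} {a : Option (Matrix (Fin n) (Fin n) ℂ)}
    {x : Atom ι n} (hx : x ∈ powerBlock i e a) : x.1 = (i, decide (0 < e)) := by
  rcases List.mem_append.1 hx with h | h
  · rw [List.eq_of_mem_replicate h]
  · rw [List.mem_singleton.1 h]

theorem snd_of_mem_powerBlock {i : ι} {e : ℤ} {a : Option (Matrix (Fin n) (Fin n) ℂ)}
    {x : Atom ι n} (hx : x ∈ powerBlock i e a) : x.2 = none ∨ x.2 = a := by
  rcases List.mem_append.1 hx with h | h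
  · rw [List.eq_of_mem_replicate h]; exact Or.inl rfl
  · rw [List.mem_singleton.1 h]; exact Or.inr rfl

theorem getLast?_powerBlock (i : ι) (e : ℤ) (a : Option (Matrix (Fin n) (Fin n) ℂ)) :
    (powerBlock i e a).getLast? = some ((i, decide (0 < e)), a) := by
  simp [powerBlock]

theorem powerBlock_ne_nil (i : ι) (e : ℤ) (a : Option (Matrix (Fin n) (Fin n) ℂ)) :
    powerBlock i e a ≠ [] := by
  simp [powerBlock]

/-- All letters of a block carry the same sign, so none cancel. -/
theorem isChain_powerBlock (i : ι) (e : ℤ) (a : Option (Matrix (Fin n) (Fin n) ℂ)) :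
    (powerBlock i e a).IsChain NoCancel := by
  refine (List.pairwise_of_forall_mem_list fun x hx y hy => ?_).isChain
  right
  rw [fst_of_mem_powerBlock hx, fst_of_mem_powerBlock hy]
  simp

theorem noCancel_of_mem_powerBlock {i j : ι} {e f : ℤ}
    {a b : Option (Matrix (Fin n) (Fin n) ℂ)} (h : a.isSome ∨ i ≠ j) {x y : Atom ι n}
    (hx : x ∈ (powerBlock i e a).getLast?) (hy : y ∈ (powerBlock j f b).head?) :
    NoCancel x y := by
  have hy' := fst_of_mem_powerBlock (List.mem_of_mem_head? hy)
  rw [getLast?_powerBlock, Option.mem_some_iff] at hx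
  subst hx
  refine h.imp id fun hij hc => hij ?_
  rw [hy'] at hc
  exact hc.1

theorem wordVal_flatten (L : List (List (Atom ι n))) (u : ι → UnitaryMat n) :
    wordVal L.flatten u = (L.map fun w => wordVal w u).prod := by
  induction L with
  | nil => rfl
  | cons w L ih => rw [List.flatten_cons, wordVal_append, ih, List.map_cons, List.prod_cons]

theorem cycReduced_flatten_powerBlock {l : ℕ} [NeZero l] (i : Fin l → ι) (e : Fin l → ℤ)
    (a : Fin l → Option (Matrix (Fin n) (Fin n) ℂ))
    (h : ∀ r, (a r).isSome ∨ i r ≠ i (r + 1)) :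
    CycReduced (List.ofFn fun r => powerBlock (i r) (e r) (a r)).flatten := by
  obtain ⟨l, rfl⟩ : ∃ k, l = k + 1 := Nat.exists_eq_succ_of_ne_zero (NeZero.ne l)
  constructor
  · rw [List.isChain_flatten]
    · refine ⟨fun w hw => ?_, ?_⟩
      · obtain ⟨r, rfl⟩ := List.mem_ofFn.1 hw
        exact isChain_powerBlock _ _ _
      · rw [List.isChain_iff_getElem]
        intro q hq x hx y hy
        rw [List.length_ofFn] at hq
        rw [List.getElem_ofFn] at hx hy
        refine noCancel_of_mem_powerBlock ?_ hx hy
        have e1 : (⟨q, by omega⟩ : Fin (l + 1)) + 1 = ⟨q + 1, hq⟩ := by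
          apply Fin.ext
          rw [Fin.val_add_one_of_lt (by rw [Fin.lt_def, Fin.val_last]; simp only; omega)]
        rw [← e1]
        exact h _
    · intro hmem
      obtain ⟨r, hr⟩ := List.mem_ofFn.1 hmem
      exact powerBlock_ne_nil _ _ _ hr
  · intro x hx y hy
    have hx' : x ∈ (powerBlock (i (Fin.last l)) (e (Fin.last l)) (a (Fin.last l))).getLast? := by
      rw [List.ofFn_succ', List.concat_eq_append, List.flatten_append, List.getLast?_append] at hx
      simpa [getLast?_powerBlock] using hx
    have hy' : y ∈ (powerBlock (i 0) (e 0) (a 0)).head? := by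
      rw [List.ofFn_succ, List.flatten_cons,
        List.head?_append_of_ne_nil _ (powerBlock_ne_nil _ _ _)] at hy
      exact hy
    refine noCancel_of_mem_powerBlock ?_ hx' hy'
    -- The cyclic addition in `Fin` turns this instance into the wrap-around condition.
    have := h (Fin.last l)
    rwa [Fin.last_add_one] at this

end Blocks

/-! ### Transfer to independent Haar unitaries -/

section Transfer

variable {S Ω : Type*} [MeasurableSpace Ω]

theorem Admissible.anti {l : ℕ} [NeZero l] {s : Fin l → S} {K K' : Set ℝ} (hK : K ⊆ K')
    {R : ℝ → ℝ} {D : Fin l → (n : ℕ) → Matrix (Fin n) (Fin n) ℂ}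
    (h : Admissible s K' R D) : Admissible s K R D :=
  fun r => (h r).imp (fun h n => ⟨(h n).1, fun p hp => (h n).2 p (hK hp)⟩) id

theorem UniformlyBigO.mono {P : Measure Ω} {l : ℕ} [NeZero l]
    {U : S → (n : ℕ) → Ω → UnitaryMat n} {s : Fin l → S} {m : Fin l → ℤ} {K K' : Set ℝ}
    (hK : K ⊆ K') {R : ℝ → ℝ} (h : UniformlyBigO P U s m K R) : UniformlyBigO P U s m K' R := by
  obtain ⟨C, N, H⟩ := h
  exact ⟨C, N, fun D hD => H D (hD.anti hK)⟩

/-- Independence makes the joint law a product of Haar measures. -/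
theorem isMulLeftInvariant_map_of_iIndepFun {P : Measure Ω} [IsProbabilityMeasure P] {ι : Type*}
    [Fintype ι] {n : ℕ} {V : ι → Ω → UnitaryMat n} (hV : iIndepFun V P)
    (hV' : ∀ i, IsStandardUnitary P (V i)) :
    (P.map fun ω i => V i ω).IsMulLeftInvariant := by
  rw [(iIndepFun_iff_map_fun_eq_pi_map fun i => (hV' i).measurable.aemeasurable).1 hV]
  have h1 : ∀ i, IsProbabilityMeasure (P.map (V i)) := fun i => (hV' i).isProbabilityMeasure
  have h2 : ∀ i, (P.map (V i)).IsHaarMeasure := fun i => (hV' i).isHaarMeasure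
  infer_instance

theorem uniformlyBigO_Icc {l : ℕ} [NeZero l] {P : Measure Ω} [IsProbabilityMeasure P]
    {U : S → (n : ℕ) → Ω → UnitaryMat n} (hU : ∀ n, iIndepFun (fun s => U s n) P)
    (hU' : ∀ s n, IsStandardUnitary P (U s n)) (s : Fin l → S) (m : Fin l → ℤ)
    (hm : ∀ r, m r ≠ 0) (R : ℝ → ℝ) (hR : ∀ p, 1 ≤ p → 0 ≤ R p) :
    UniformlyBigO P U s m (Set.Icc 1 (2 ^ (l + 1))) R := by
  classical
  -- One bound for all moments of levels 0 to l, independent of n and D.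
  set B : ℝ := 1 + ∑ j ∈ Finset.range (l + 1), R (2 ^ (j + 1)) ^ 2 ^ (j + 1) with hBdef
  have hpow : ∀ j : ℕ, (1 : ℝ) ≤ 2 ^ (j + 1) := fun j => one_le_pow₀ (by norm_num)
  have hnn : ∀ j ∈ Finset.range (l + 1), 0 ≤ R (2 ^ (j + 1)) ^ 2 ^ (j + 1) :=
    fun j _ => pow_nonneg (hR _ (hpow j)) _
  have hB : 1 ≤ B := by rw [hBdef]; linarith [Finset.sum_nonneg hnn]
  have hBj : ∀ j ≤ l, R (2 ^ (j + 1)) ^ 2 ^ (j + 1) ≤ B := by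
    intro j hj
    have := Finset.single_le_sum hnn (Finset.mem_range.2 (by omega : j < l + 1))
    rw [hBdef]; linarith
  -- Restricting to the range of s makes the index set finite; there are at most l coefficients,
  -- hence J = l.
  obtain ⟨C, -, H⟩ := traceDecay (ι := Set.range s) (∑ r, (m r).natAbs) l B hB
  refine ⟨C, 1, fun D hD n hn => ?_⟩
  set i : Fin l → Set.range s := fun r => ⟨s r, Set.mem_range_self r⟩ with hi
  -- The identity is encoded as `none` exactly under the second alternative, so each `some`
  -- coefficient satisfies the first.
  set a : Fin l → Option (Matrix (Fin n) (Fin n) ℂ) := fun r =>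
    if s r ≠ s (r + 1) ∧ ∀ n, D r n = 1 then none else some (D r n) with ha
  set w : List (Atom (Set.range s) n) :=
    (List.ofFn fun r => powerBlock (i r) (m r) (a r)).flatten with hw
  set V : Ω → Set.range s → UnitaryMat n := fun ω j => U j n ω with hV
  have hword : ∀ ω, unitaryWord (fun r => U (s r) n ω) m (fun r => D r n) = wordVal w (V ω) := by
    intro ω
    rw [hw, wordVal_flatten, List.map_ofFn, unitaryWord]
    congr 2
    funext r
    rw [Function.comp_apply, wordVal_powerBlock _ (hm r)]
    congr 1
    simp only [ha]
    split_ifs with h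
    · rw [h.2 n]; rfl
    · rfl
  have hred : CycReduced w := by
    refine cycReduced_flatten_powerBlock i m a fun r => ?_
    by_cases h : s r ≠ s (r + 1) ∧ ∀ n, D r n = 1
    · exact Or.inr fun hc => h.1 (congrArg Subtype.val hc)
    · left; simp only [ha, if_neg h, Option.isSome_some]
  have hbound : WordBound l B w := by
    refine ⟨fun x hx A hA => ?_, ?_⟩
    · obtain ⟨b, hb, hxb⟩ := List.mem_flatten.1 hx
      obtain ⟨r, rfl⟩ := List.mem_ofFn.1 hb
      rcases snd_of_mem_powerBlock hxb with h | h
      · rw [h] at hA; cases hA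
      rw [h] at hA
      simp only [ha] at hA
      split_ifs at hA with hr
      obtain rfl : D r n = A := Option.some.inj hA
      rcases hD r with h | h
      · refine ⟨(h n).1, fun j hj => ?_⟩
        refine (dyadicMoment_le_of_schattenNorm_le ((h n).2 _ ⟨hpow j, ?_⟩)).trans (hBj j hj)
        exact pow_le_pow_right₀ (by norm_num) (by omega)
      · exact absurd ⟨h.2, h.1⟩ hr
    · rw [hw, List.countP_flatten, List.map_ofFn, List.sum_ofFn]
      calc _ ≤ ∑ _r : Fin l, 1 := Finset.sum_le_sum fun r _ => countP_powerBlock_le _ _ _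
        _ = l := by simp
  have hlen : w.length = ∑ r, (m r).natAbs := by
    rw [hw, List.length_flatten, List.map_ofFn, List.sum_ofFn]
    exact Finset.sum_congr rfl fun r _ => length_powerBlock _ (hm r) _
  have hne : w ≠ [] := by
    intro h
    rw [h, List.length_nil] at hlen
    have := Finset.sum_eq_zero_iff.1 hlen.symm 0 (Finset.mem_univ _)
    exact hm 0 (Int.natAbs_eq_zero.1 this)
  have hVm : Measurable V := measurable_pi_lambda _ fun j => (hU' j n).measurable
  have hprob : IsProbabilityMeasure (P.map V) := Measure.isProbabilityMeasure_map hVm.aemeasurable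
  have hinv : (P.map V).IsMulLeftInvariant :=
    isMulLeftInvariant_map_of_iIndepFun ((hU n).precomp Subtype.val_injective) fun j => hU' j n
  have hcont : Continuous fun u : Set.range s → UnitaryMat n => ‖ntr (wordVal w u)‖ ^ 2 :=
    ((continuous_ntr (continuous_wordVal _)).norm).pow 2
  have hint : Integrable (fun u => ‖ntr (wordVal w u)‖ ^ 2) (P.map V) :=
    integrable_of_continuous hcont
  simp only [hword]
  refine ⟨hint.comp_measurable hVm, ?_⟩
  have := H n (by omega) (P.map V) w hne hlen.le hred hbound
  rwa [integral_map hVm.aemeasurable hcont.aestronglyMeasurable] at this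

end Transfer

end

theorem theorem3p1 (l : ℕ) [NeZero l] :
    ∃ p_l : ℝ, 1 ≤ p_l ∧
      ∀ (S : Type*) (Ω : Type*) [MeasurableSpace Ω] (P : Measure Ω) [IsProbabilityMeasure P]
        (U : S → (n : ℕ) → Ω → UnitaryMat n),
        (∀ n, iIndepFun (fun s => U s n) P) →
        (∀ s n, IsStandardUnitary P (U s n)) →
        ∀ (s : Fin l → S) (m : Fin l → ℤ), (∀ r, m r ≠ 0) →
        ∀ R : ℝ → ℝ, (∀ p, 1 ≤ p → 0 ≤ R p) →
          UniformlyBigO P U s m (Set.Ici 1) R ∧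
          UniformlyBigO P U s m (Set.Icc 1 p_l) R := by
  -- Level l of the moments corresponds to the exponent 2^(l+1).
  refine ⟨2 ^ (l + 1), one_le_pow₀ (by norm_num), ?_⟩
  intro S Ω _ P _ U hU hU' s m hm R hR
  have h := uniformlyBigO_Icc hU hU' s m hm R hR
  exact ⟨h.mono Set.Icc_subset_Ici_self, h⟩
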